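/- **Proposition 2.3.** For a finite set $S\subset\mathbb C^2$ let $m_2(S)$ be the maximum number of points of $S$ contained in an algebraic curve of degree $2$ (possibly reducible) in $\mathbb C^2$. Let $S\subset\mathbb C^2$ satisfy $|S|=7$ and $m_2(S)=5$. Then $S$ has an entire pluricomplex Green function $u$ with $$\gamma_u:=\limsup_{\|z\|\to\infty}\frac{u(z)}{\log\|z\|}=4,$$ that is, there is a plurisubharmonic function $u$ on $\mathbb C^2$ with $\gamma_u=4$ that is locally bounded and maximal on $\mathbb C^2\setminus S$ and equals $-\infty$ on $S$. Moreover $u$ can be chosen so that it has logarithmic poles of weight $2$ at three of the points of $S$ and logarithmic poles of weight $1$ at the remaining four points, where a logarithmic pole of weight $\alpha>0$ at $p$ means that $u(z)=\alpha\log\|z-p\|+O(1)$ for $z$ near $p$, and so that $$u=\tfrac12\log\left(|P_1|^2+|P_2|^2\right)$$ for two polynomials $P_1,P_2\in\mathbb C[z_1,z_2]$ of degree $4$ with no common factor. Here maximality of $u$ on an open set $\Omega$ means: for every open $G$ with compact closure $\overline G\subset\Omega$ and every upper semicontinuous $v$ on $\overline G$ that is plurisubharmonic on $G$, if $v\le u$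 on $\partial G$ then $v\le u$ on $G$. -/

import Mathlib

open Set Filter Topology MeasureTheory

noncomputable section

/-- The mean value `(1/2π) ∫₀^{2π} f(θ) dθ` of an extended-real function, as the mean of the positive
part minus the mean of the negative part. It is only used for functions that are bounded above,
so the first term is finite and the difference is never `∞ - ∞`. -/
def angularMean (f : ℝ → EReal) : EReal :=
  ((laverage (volume.restrict (Ioc 0 (2 * Real.pi))) fun θ => (f θ).toENNReal : ENNReal) : EReal) -
    ((laverage (volume.restrict (Ioc 0 (2 * Real.pi))) fun θ => (-f θ).toENNReal : ENNReal) : EReal)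

/-- `u` is plurisubharmonic on the (open) set `D`: it takes values in `[-∞, ∞)` and is upper
semicontinuous on `D`, and it satisfies the sub-mean value inequality on every closed disc
`{a + ζ b : |ζ| ≤ 1}` of a complex line that is contained in `D`. -/
structure PlurisubharmonicOn {n : ℕ} (u : EuclideanSpace ℂ (Fin n) → EReal)
    (D : Set (EuclideanSpace ℂ (Fin n))) : Prop where
  lt_top : ∀ z ∈ D, u z < ⊤
  usc : UpperSemicontinuousOn u D
  le_mean : ∀ a b : EuclideanSpace ℂ (Fin n), (∀ ζ : ℂ, ‖ζ‖ ≤ 1 → a + ζ • b ∈ D) →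
    u a ≤ angularMean (fun θ => u (a + Complex.exp (θ * Complex.I) • b))

/-- `u` is maximal plurisubharmonic on the (open) set `D`: for every open `G` relatively compact
in `D` and every upper semicontinuous `v` on the closure of `G` that is plurisubharmonic on `G`,
`v ≤ u` on the boundary of `G` implies `v ≤ u` on `G`. -/
structure IsMaximalPSHOn {n : ℕ} (u : EuclideanSpace ℂ (Fin n) → EReal)
    (D : Set (EuclideanSpace ℂ (Fin n))) : Prop where
  psh : PlurisubharmonicOn u D
  le_of_le_frontier : ∀ (G : Set (EuclideanSpace ℂ (Fin n)))
    (v : EuclideanSpace ℂ (Fin n) → EReal),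
    IsOpen G → IsCompact (closure G) → closure G ⊆ D →
    UpperSemicontinuousOn v (closure G) → PlurisubharmonicOn v G →
    (∀ z ∈ frontier G, v z ≤ u z) → ∀ z ∈ G, v z ≤ u z

/-- `u` is locally bounded on the (open) set `D`. -/
def IsLocallyBoundedOn {n : ℕ} (u : EuclideanSpace ℂ (Fin n) → EReal)
    (D : Set (EuclideanSpace ℂ (Fin n))) : Prop :=
  ∀ z ∈ D, ∃ C : ℝ, ∀ᶠ w in 𝓝 z, ((-C : ℝ) : EReal) ≤ u w ∧ u w ≤ (C : EReal)

/-- The growth constant `γ_u = limsup_{‖z‖ → ∞} u(z) / log ‖z‖`. -/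
def growthConstant {n : ℕ} (u : EuclideanSpace ℂ (Fin n) → EReal) : EReal :=
  limsup (fun z => u z / ((Real.log ‖z‖ : ℝ) : EReal))
    (Bornology.cobounded (EuclideanSpace ℂ (Fin n)))

/-- `u` has a logarithmic pole of weight `α > 0` at `p`: near `p` one has
`u(z) = α log ‖z - p‖ + O(1)`, with `log 0 = -∞`. -/
def HasLogPole {n : ℕ} (u : EuclideanSpace ℂ (Fin n) → EReal) (α : ℝ)
    (p : EuclideanSpace ℂ (Fin n)) : Prop :=
  0 < α ∧ ∃ C : ℝ, ∀ᶠ z in 𝓝 p,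
    (α : EReal) * ENNReal.log ‖z - p‖ₑ - (C : EReal) ≤ u z ∧
      u z ≤ (α : EReal) * ENNReal.log ‖z - p‖ₑ + (C : EReal)

/-- `u` is an entire pluricomplex Green function of the finite set `S`. -/
structure IsEntireGreenFunction {n : ℕ} (S : Finset (EuclideanSpace ℂ (Fin n)))
    (u : EuclideanSpace ℂ (Fin n) → EReal) : Prop where
  psh : PlurisubharmonicOn u univ
  log_growth : growthConstant u < ⊤
  locally_bounded : IsLocallyBoundedOn u (S : Set (EuclideanSpace ℂ (Fin n)))ᶜ
  maximal : IsMaximalPSHOn u (S : Set (EuclideanSpace ℂ (Fin n)))ᶜ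
  eq_bot : ∀ p ∈ S, u p = ⊥

/-- The zero set in `ℂ²` of a polynomial in two variables. -/
def planeCurve (P : MvPolynomial (Fin 2) ℂ) : Set (EuclideanSpace ℂ (Fin 2)) :=
  {z | MvPolynomial.eval (fun i => z i) P = 0}

/-- `m_j(S)`: the maximum number of points of `S` that lie on an algebraic curve of degree `j`
in `ℂ²`, possibly reducible. (Allowing repeated factors does not change the maximum: a repeated
factor can be replaced by further lines.) -/
def maxPointsOnCurve (j : ℕ) (S : Finset (EuclideanSpace ℂ (Fin 2))) : ℕ :=
  sSup {k | ∃ P : MvPolynomial (Fin 2) ℂ, P ≠ 0 ∧ P.totalDegree = j ∧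
    k = ((S : Set (EuclideanSpace ℂ (Fin 2))) ∩ planeCurve P).ncard}

end

/-! The function is `u = ½ log (|AB|² + |CE|²)` for four conics through a suitable triangle `t₁ t₂
t₃` of points of `S`. If `p₁, …, p₄` are the other points, `A` passes through `p₁, p₂`, `B` through
`p₃, p₄`, `C` through `p₁, p₃` and `E` through `p₂, p₄`. By Bezout, one of `A, B` and one of `C, E`
meet exactly in the triangle and one `pᵢ`, transversally and with nothing left at infinity. Hence
the common zeros of `AB` and `CE` are the points of `S`, and `|AB|² + |CE|²` is comparable to `‖z -
t‖⁴` at a vertex, to `‖z - p‖²` at a `pᵢ` and to `‖z‖⁸` at infinity. Half the logarithm gives the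
weights 2 and 1 and the growth 4. Coprimality follows from the finiteness of the common zero set.

The triangle must have no further point of `S` on its sides (`exists_triangle`). Since a conic
contains at most five points of `S`, no four points are collinear and any two three-point lines meet
in `S`; otherwise a pair of lines would contain six points. Such a configuration has the desired
triangle unless it is the Fano plane (`exists_ordinary_triangle`), which does not exist over `ℂ`
(`fano_not_realizable`).

Bezout is replaced by explicit estimates. In barycentric coordinates the Cremona map `(x, y, w) ↦
(yw, xw, xy)` turns conics through the triangle into lines. Two of the conics through `p`, not
having a third `pᵢ` in common, become independent linear forms vanishing at the image of `p`, so
together they control the distance to that image (`exists_cremonaDist_le`). It remains to bound this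
distance below near the vertices, near `p` and at infinity.

Plurisubharmonicity and maximality hold for any two polynomials, the latter off their common zeros
in `ℂ²`. By Lagrange's identity `u` is bounded below by a function `log |H|` plus a constant, with
equality at the base point. Along a direction in which the error term in that identity vanishes to
second order, `u` is harmonic up to `O(r⁴)`. This contradicts a strict interior maximum of `v - u +
ε‖z‖²`, whose mean grows by a multiple of `r²`. -/

/-! ### Combinatorics of seven points and their three-point lines. -/

/-- If three lines `p x x'`, `p y y'`, `p z z'` through a point `p` cover a point-line configuration,
then a line through `x` and `y` contains `z` or `z'`. -/
theorem eq_or_eq_of_transversal {α : Type*} {S : Finset α} {col : α → α → α → Prop}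
    (hmem : ∀ a b c, col a b c → a ∈ S ∧ a ≠ b)
    (h1 : ∀ a b c, col a b c → col b a c) (h2 : ∀ a b c, col a b c → col a c b)
    (h4 : ∀ a b c d, col a b c → col a b d → c = d)
    {p x x' y y' z z' : α} (hx : col p x x') (hy : col p y y') (hxy : x ≠ y) (hxy' : x ≠ y')
    (hS : ∀ w ∈ S, w = p ∨ w = x ∨ w = x' ∨ w = y ∨ w = y' ∨ w = z ∨ w = z')
    {w : α} (hw : col x y w) : w = z ∨ w = z' := by
  have hw1 := h2 _ _ _ (h1 _ _ _ (h2 _ _ _ hw))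
  have hx1 := h1 _ _ _ hx
  have hy1 := h1 _ _ _ hy
  have hy2 := h2 _ _ _ hy
  have hd := fun d => h4 p x x' d hx
  have he := fun d => h4 x x' p d (h2 _ _ _ hx1)
  have hf := fun d => h4 y y' p d (h2 _ _ _ hy1)
  -- If `w` were on one of the lines `p x x'`, `p y y'`, the line `x y` would have two points in
  -- common with it and hence coincide with it.
  rcases hS w (hmem _ _ _ (h1 _ _ _ (h2 _ _ _ hw))).1 with rfl | rfl | rfl | rfl | rfl | h
  · grind
  · grind
  · have := h4 _ _ _ _ (h2 _ _ _ hw) (h2 _ _ _ hx1)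
    grind
  · grind
  · have := h4 _ _ _ _ (h2 _ _ _ (h1 _ _ _ hw)) (h2 _ _ _ hy1)
    grind
  · exact h

/-- Three concurrent lines covering a configuration of points and three-point lines which is not the
Fano plane and in which any two lines meet have a transversal without lines through two of its
points. -/
theorem not_forall_exists_line_of_three_concurrent {α : Type*} {S : Finset α}
    {col : α → α → α → Prop}
    (hmem : ∀ a b c, col a b c → a ∈ S ∧ a ≠ b)
    (h1 : ∀ a b c, col a b c → col b a c) (h2 : ∀ a b c, col a b c → col a c b)
    (h4 : ∀ a b c d, col a b c → col a b d → c = d)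
    (h33 : ∀ a b c d e f, col a b c → col d e f →
      a = d ∨ a = e ∨ a = f ∨ b = d ∨ b = e ∨ b = f ∨ c = d ∨ c = e ∨ c = f)
    (hF : ∀ p a a' b b' c c', col p a a' → col p b b' → col p c c' →
      col a b c → col a b' c' → col a' b c' → col a' b' c → False)
    (H : ∀ x ∈ S, ∀ y ∈ S, ∀ z ∈ S, x ≠ y → x ≠ z → y ≠ z →
      (∃ w, col x y w) ∨ (∃ w, col x z w) ∨ (∃ w, col y z w))
    {p a a' b b' c c' : α} (hA : col p a a') (hB : col p b b') (hC : col p c c')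
    (hab : a ≠ b) (hab' : a ≠ b') (ha'b : a' ≠ b) (ha'b' : a' ≠ b')
    (hac : a ≠ c) (hac' : a ≠ c') (ha'c : a' ≠ c) (ha'c' : a' ≠ c')
    (hbc : b ≠ c) (hbc' : b ≠ c') (hb'c : b' ≠ c) (hb'c' : b' ≠ c')
    (hSc : ∀ w ∈ S, w = p ∨ w = a ∨ w = a' ∨ w = b ∨ w = b' ∨ w = c ∨ w = c') : False := by
  have hm2 : ∀ a b c, col a b c → b ∈ S ∧ c ∈ S ∧ a ≠ c ∧ b ≠ c := fun a b c h =>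
    ⟨(hmem _ _ _ (h1 _ _ _ h)).1, (hmem _ _ _ (h1 _ _ _ (h2 _ _ _ h))).1,
      (hmem _ _ _ (h2 _ _ _ h)).2, (hmem _ _ _ (h2 _ _ _ (h1 _ _ _ h))).2⟩
  have haa' := (hm2 _ _ _ hA).2.2.2
  have hbb' := (hm2 _ _ _ hB).2.2.2
  have hcc' := (hm2 _ _ _ hC).2.2.2
  -- Regard the eight transversals as the vertices of a cube, with a change of one point as an edge.
  -- `key` says that each vertex is a line or is adjacent to one. The facts `adj1`, `adj2`, `adj3`
  -- exclude two adjacent lines, which would share two points, and `opp` excludes two antipodal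
  -- ones, which would be disjoint.
  have key : ∀ x x' y y' z z', col p x x' → col p y y' → col p z z' → x ≠ y → x ≠ z → y ≠ z →
      x ≠ y' → x ≠ z' → y ≠ z' →
      (∀ w ∈ S, w = p ∨ w = x ∨ w = x' ∨ w = y ∨ w = y' ∨ w = z ∨ w = z') →
      col x y z ∨ col x y z' ∨ col x y' z ∨ col x' y z := by
    intro x x' y y' z z' hx hy hz hxy hxz hyz hxy' hxz' hyz' hc
    rcases H x (hm2 _ _ _ hx).1 y (hm2 _ _ _ hy).1 z (hm2 _ _ _ hz).1 hxy hxz hyz with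
      ⟨w, hw⟩ | ⟨w, hw⟩ | ⟨w, hw⟩
    · rcases eq_or_eq_of_transversal hmem h1 h2 h4 hx hy hxy hxy' hc hw with rfl | rfl <;> tauto
    · have := h2 _ _ _ hw
      rcases eq_or_eq_of_transversal hmem h1 h2 h4 hx hz hxz hxz'
        (z := y) (z' := y') (fun w hw => by have := hc w hw; clear * - this; tauto) hw with rfl | rfl <;> tauto
    · have := h1 _ _ _ (h2 _ _ _ hw)
      rcases eq_or_eq_of_transversal hmem h1 h2 h4 hy hz hyz hyz'
        (z := x) (z' := x') (fun w hw => by have := hc w hw; clear * - this; tauto) hw with rfl | rfl <;> tauto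
  have adj1 : ∀ x y z z', z ≠ z' → col x y z → ¬ col x y z' := fun x y z z' h k k' =>
    h (h4 _ _ _ _ k k')
  have adj2 : ∀ x y y' z, y ≠ y' → col x y z → ¬ col x y' z := fun x y y' z h k k' =>
    h (h4 _ _ _ _ (h2 _ _ _ k) (h2 _ _ _ k'))
  have adj3 : ∀ x x' y z, x ≠ x' → col x y z → ¬ col x' y z := fun x x' y z h k k' =>
    h (h4 _ _ _ _ (h2 _ _ _ (h1 _ _ _ k)) (h2 _ _ _ (h1 _ _ _ k')))
  have opp : ∀ x x' y y' z z', x ≠ x' → x ≠ y' → x ≠ z' → y ≠ x' → y ≠ y' → y ≠ z' →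
      z ≠ x' → z ≠ y' → z ≠ z' → col x y z → ¬ col x' y' z' := by
    intro x x' y y' z z' _ _ _ _ _ _ _ _ _ k k'
    have := h33 _ _ _ _ _ _ k k'
    clear h33 h4 h2 h1 hmem hF H hSc hm2 key adj1 adj2 adj3 k k' hA hB hC hab hab' ha'b ha'b' hac hac' ha'c ha'c' hbc hbc' hb'c hb'c' haa' hbb' hcc'
    tauto
  have hA' := h2 _ _ _ hA
  have hB' := h2 _ _ _ hB
  have hC' := h2 _ _ _ hC
  have k1 := key a a' b b' c c' hA hB hC hab hac hbc hab' hac' hbc' hSc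
  have k2 := key a a' b b' c' c hA hB hC' hab hac' hbc' hab' hac hbc
    fun w hw => by have := hSc w hw; clear * - this; tauto
  have k3 := key a a' b' b c c' hA hB' hC hab' hac hb'c hab hac' hb'c'
    fun w hw => by have := hSc w hw; clear * - this; tauto
  have k4 := key a a' b' b c' c hA hB' hC' hab' hac' hb'c' hab hac hb'c
    fun w hw => by have := hSc w hw; clear * - this; tauto
  have k5 := key a' a b b' c c' hA' hB hC ha'b ha'c hbc ha'b' ha'c' hbc'
    fun w hw => by have := hSc w hw; clear * - this; tauto
  have k6 := key a' a b b' c' c hA' hB hC' ha'b ha'c' hbc' ha'b' ha'c hbc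
    fun w hw => by have := hSc w hw; clear * - this; tauto
  have k7 := key a' a b' b c c' hA' hB' hC ha'b' ha'c hb'c ha'b ha'c' hb'c'
    fun w hw => by have := hSc w hw; clear * - this; tauto
  have k8 := key a' a b' b c' c hA' hB' hC' ha'b' ha'c' hb'c' ha'b ha'c hb'c
    fun w hw => by have := hSc w hw; clear * - this; tauto
  -- So all lines among the vertices have the same parity of primes, and a vertex of that parity can
  -- only satisfy `key` by being a line itself. All four vertices of one parity are then lines,
  -- which is a Fano plane. `f1` and `f2` exclude the two parities.
  have f1 := hF p a a' b b' c c' hA hB hC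
  have f2 := hF p a a' b b' c' c hA hB hC'
  have o1 := opp a a' b b' c c' haa' hab' hac' ha'b.symm hbb' hbc' ha'c.symm hb'c.symm hcc'
  have o2 := opp a a' b b' c' c haa' hab' hac ha'b.symm hbb' hbc ha'c'.symm hb'c'.symm hcc'.symm
  have o3 := opp a a' b' b c c' haa' hab hac' ha'b'.symm hbb'.symm hb'c' ha'c.symm hbc.symm hcc'
  have o4 := opp a a' b' b c' c haa' hab hac ha'b'.symm hbb'.symm hb'c ha'c'.symm hbc'.symm
    hcc'.symm
  have p1 := adj1 a b c c' hcc'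
  have p2 := adj1 a b' c c' hcc'
  have p3 := adj1 a' b c c' hcc'
  have p4 := adj1 a' b' c c' hcc'
  have q1 := adj2 a b b' c hbb'
  have q2 := adj2 a b b' c' hbb'
  have q3 := adj2 a' b b' c hbb'
  have q4 := adj2 a' b b' c' hbb'
  have r1 := adj3 a a' b c haa'
  have r2 := adj3 a a' b c' haa'
  have r3 := adj3 a a' b' c haa'
  have r4 := adj3 a a' b' c' haa'
  clear key adj1 adj2 adj3 opp hSc hF H h33 h4 h2 h1 hmem hm2
  grind

/-- A configuration of seven points and three-point lines in which any two lines meet and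
which is not the Fano plane has three points such that no line passes through two of them. -/
theorem exists_ordinary_triangle {α : Type*} [DecidableEq α] (S : Finset α) (hS : S.card = 7)
    (col : α → α → α → Prop)
    (hmem : ∀ a b c, col a b c → a ∈ S ∧ a ≠ b)
    (h1 : ∀ a b c, col a b c → col b a c) (h2 : ∀ a b c, col a b c → col a c b)
    (h4 : ∀ a b c d, col a b c → col a b d → c = d)
    (h33 : ∀ a b c d e f, col a b c → col d e f →
      a = d ∨ a = e ∨ a = f ∨ b = d ∨ b = e ∨ b = f ∨ c = d ∨ c = e ∨ c = f)
    (hF : ∀ p a a' b b' c c', col p a a' → col p b b' → col p c c' →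
      col a b c → col a b' c' → col a' b c' → col a' b' c → False) :
    ∃ x ∈ S, ∃ y ∈ S, ∃ z ∈ S, x ≠ y ∧ x ≠ z ∧ y ≠ z ∧
      (∀ w, ¬ col x y w) ∧ (∀ w, ¬ col x z w) ∧ (∀ w, ¬ col y z w) := by
  by_contra! H
  have ext : ∀ T : Finset α, T.card < 7 → ∃ x ∈ S, x ∉ T := fun T hT =>
    Finset.exists_mem_notMem_of_card_lt_card (by omega)
  have H' : ∀ x ∈ S, ∀ y ∈ S, ∀ z ∈ S, x ≠ y → x ≠ z → y ≠ z →
      (∃ w, col x y w) ∨ (∃ w, col x z w) ∨ (∃ w, col y z w) := by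
    intro x hx y hy z hz hxy hxz hyz
    by_contra! h
    obtain ⟨w, hw⟩ := H x hx y hy z hz hxy hxz hyz h.1 h.2.1
    exact h.2.2 w hw
  clear H
  have hm2 : ∀ a b c, col a b c → b ∈ S ∧ c ∈ S ∧ a ≠ c ∧ b ≠ c := fun a b c h =>
    ⟨(hmem _ _ _ (h1 _ _ _ h)).1, (hmem _ _ _ (h1 _ _ _ (h2 _ _ _ h))).1,
      (hmem _ _ _ (h2 _ _ _ h)).2, (hmem _ _ _ (h2 _ _ _ (h1 _ _ _ h))).2⟩
  obtain ⟨p, hp⟩ : S.Nonempty := by rw [← Finset.card_pos]; omega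
  -- The cases are the number of lines through a fixed point `p`: at least three, exactly two,
  -- exactly one, none.
  by_cases hA : ∃ a a', col p a a'
  · obtain ⟨a, a', hA⟩ := hA
    by_cases hB : ∃ b b', col p b b' ∧ b ≠ a ∧ b ≠ a'
    · obtain ⟨b, b', hB, hba, hba'⟩ := hB
      have hb'a : b' ≠ a := fun h => hba' (h4 _ _ _ _ (h ▸ h2 _ _ _ hB) hA)
      have hb'a' : b' ≠ a' := fun h => hba (h4 _ _ _ _ (h ▸ h2 _ _ _ hB) (h2 _ _ _ hA))
      by_cases hC : ∃ c c', col p c c' ∧ c ≠ a ∧ c ≠ a' ∧ c ≠ b ∧ c ≠ b'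
      · obtain ⟨c, c', hC, hca, hca', hcb, hcb'⟩ := hC
        have hc'a : c' ≠ a := fun h => hca' (h4 _ _ _ _ (h ▸ h2 _ _ _ hC) hA)
        have hc'a' : c' ≠ a' := fun h => hca (h4 _ _ _ _ (h ▸ h2 _ _ _ hC) (h2 _ _ _ hA))
        have hc'b : c' ≠ b := fun h => hcb' (h4 _ _ _ _ (h ▸ h2 _ _ _ hC) hB)
        have hc'b' : c' ≠ b' := fun h => hcb (h4 _ _ _ _ (h ▸ h2 _ _ _ hC) (h2 _ _ _ hB))
        have hSc : ∀ w ∈ S, w = p ∨ w = a ∨ w = a' ∨ w = b ∨ w = b' ∨ w = c ∨ w = c' := by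
          have hsub : ({p, a, a', b, b', c, c'} : Finset α) = S := by
            have ma := hmem _ _ _ hA
            have mb := hmem _ _ _ hB
            have mc := hmem _ _ _ hC
            have na := hm2 _ _ _ hA
            have nb := hm2 _ _ _ hB
            have nc := hm2 _ _ _ hC
            apply Finset.eq_of_subset_of_card_le
            · intro w hw
              simp only [Finset.mem_insert, Finset.mem_singleton] at hw
              rcases hw with rfl | rfl | rfl | rfl | rfl | rfl | rfl
              exacts [hp, na.1, na.2.1, nb.1, nb.2.1, nc.1, nc.2.1]
            · rw [hS]
              have : [p, a, a', b, b', c, c'].Nodup := by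
                simp only [List.nodup_cons, List.mem_cons, List.not_mem_nil]
                clear H' ext h33 hF h4 h1 h2 hmem hm2
                grind
              exact (List.toFinset_card_of_nodup this).symm.le.trans (Finset.card_le_card
                (by intro w; simp))
          intro w hw
          rw [← hsub] at hw
          simpa using hw
        exact not_forall_exists_line_of_three_concurrent hmem h1 h2 h4 h33 hF H' hA hB hC
          hba.symm hb'a.symm hba'.symm hb'a'.symm hca.symm hc'a.symm hca'.symm hc'a'.symm
          hcb.symm hc'b.symm hcb'.symm hc'b'.symm hSc
      · obtain ⟨c, hc, hcn⟩ := ext {p, a, a', b, b'} (Finset.card_le_five.trans_lt (by norm_num))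
        obtain ⟨c', hc', hcn'⟩ := ext {p, a, a', b, b', c}
          (Finset.card_le_six.trans_lt (by norm_num))
        simp only [Finset.mem_insert, Finset.mem_singleton, not_or] at hcn hcn'
        rcases H' p hp c hc c' hc' (Ne.symm hcn.1) (Ne.symm hcn'.1)
          (Ne.symm hcn'.2.2.2.2.2) with ⟨w, hw⟩ | ⟨w, hw⟩ | ⟨w, hw⟩
        · exact hC ⟨c, w, hw, hcn.2⟩
        · exact hC ⟨c', w, hw, by clear * - hcn'; tauto⟩
        -- With exactly two lines through `p`, a line through the two uncovered points `c, c'` must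
        -- meet both of them in its third point, which is therefore `p`: a third line through `p`.
        · have e1 := h33 _ _ _ _ _ _ hA hw
          have e2 := h33 _ _ _ _ _ _ hB hw
          have hwp : w = p := by
            clear H' ext h33 hF h4 h1 h2 hmem hm2
            have e3 : w = p ∨ w = a ∨ w = a' := by clear * - e1 hcn hcn'; tauto
            have e4 : w = p ∨ w = b ∨ w = b' := by clear * - e2 hcn hcn'; tauto
            clear * - e3 e4 hba hba' hb'a hb'a'
            rcases e3 with rfl | rfl | rfl
            · rfl
            · tauto
            · tauto
          subst hwp
          exact hC ⟨c, c', h1 _ _ _ (h2 _ _ _ hw), hcn.2⟩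
    · have hT : 2 < (S \ {p, a, a'}).card := by
        have := Finset.le_card_sdiff {p, a, a'} S
        have := Finset.card_le_three (a := p) (b := a) (c := a')
        omega
      obtain ⟨b, hb, hbn⟩ := ext {p, a, a'} (Finset.card_le_three.trans_lt (by norm_num))
      have hT : 2 < (S \ {p, a, a', b}).card := by
        have := Finset.le_card_sdiff {p, a, a', b} S
        have := Finset.card_le_four (a := p) (b := a) (c := a') (d := b)
        omega
      obtain ⟨d, hd, e, he, f, hf, hde, hdf, hef⟩ := Finset.two_lt_card.1 hT
      -- With one line through `p`, any two points off it are joined by a line, which meets `p a a'`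
      -- in `a` or `a'`. Of the three remaining points, two would be joined to `b` through the same
      -- one of these.
      have key : ∀ d ∈ S \ {p, a, a', b}, col b d a ∨ col b d a' := by
        intro d hd
        simp only [Finset.mem_insert, Finset.mem_singleton, not_or, Finset.mem_sdiff] at hd hbn
        have hnb : ∀ w, ¬ col p b w := fun w hw => hB ⟨b, w, hw, hbn.2⟩
        have hnd : ∀ w, ¬ col p d w := fun w hw => hB ⟨d, w, hw, hd.2.2.1, hd.2.2.2.1⟩
        obtain ⟨w, hw⟩ : ∃ w, col b d w := by
          have := H' p hp b hb d hd.1 (Ne.symm hbn.1) (Ne.symm hd.2.1) (Ne.symm hd.2.2.2.2)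
          rcases this with ⟨w, hw⟩ | ⟨w, hw⟩ | h
          · exact absurd hw (hnb w)
          · exact absurd hw (hnd w)
          · exact h
        have hwp : w ≠ p := by
          rintro rfl
          exact hnb _ (h1 _ _ _ (h2 _ _ _ hw))
        have := h33 _ _ _ _ _ _ hA hw
        have : w = a ∨ w = a' := by
          clear * - this hbn hd hwp
          tauto
        rcases this with rfl | rfl
        · exact Or.inl hw
        · exact Or.inr hw
      have uniq : ∀ d e x, d ≠ e → col b d x → ¬ col b e x := fun d e x h k k' =>
        h (h4 _ _ _ _ (h2 _ _ _ k) (h2 _ _ _ k'))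
      have kd := key d hd
      have ke := key e he
      have kf := key f hf
      have u1 := uniq d e a hde
      have u2 := uniq d f a hdf
      have u3 := uniq e f a hef
      have u4 := uniq d e a' hde
      have u5 := uniq d f a' hdf
      have u6 := uniq e f a' hef
      clear * - kd ke kf u1 u2 u3 u4 u5 u6
      tauto
  · have hord : ∀ x w, ¬ col p x w := fun x w h => hA ⟨x, w, h⟩
    -- With no line through `p`, any two of the other points are on a line. The lines through `b`
    -- then split the five points other than `p, b` into pairs, which is impossible; three such
    -- pairs would give eight points in `S`.
    have hpart : ∀ x ∈ S, ∀ y ∈ S, p ≠ x → p ≠ y → x ≠ y → ∃ w, col x y w ∧ w ≠ p := by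
      intro x hx y hy hpx hpy hxy
      rcases H' p hp x hx y hy hpx hpy hxy with ⟨w, hw⟩ | ⟨w, hw⟩ | ⟨w, hw⟩
      · exact absurd hw (hord _ _)
      · exact absurd hw (hord _ _)
      · refine ⟨w, hw, ?_⟩
        rintro rfl
        exact hord _ _ (h1 _ _ _ (h2 _ _ _ hw))
    obtain ⟨b, hb, hbn⟩ := ext {p} (by simp)
    obtain ⟨d, hd, hdn⟩ := ext {p, b} (Finset.card_le_two.trans_lt (by norm_num))
    simp only [Finset.mem_insert, Finset.mem_singleton, not_or] at hbn hdn
    obtain ⟨e, he, hep⟩ := hpart b hb d hd (Ne.symm hbn) (Ne.symm hdn.1) (Ne.symm hdn.2)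
    obtain ⟨f, hf, hfn⟩ := ext {p, b, d, e} (Finset.card_le_four.trans_lt (by norm_num))
    simp only [Finset.mem_insert, Finset.mem_singleton, not_or] at hfn
    obtain ⟨g, hg, hgp⟩ := hpart b hb f hf (Ne.symm hbn) (Ne.symm hfn.1) (Ne.symm hfn.2.1)
    obtain ⟨h, hh, hhn⟩ := ext {p, b, d, e, f, g} (Finset.card_le_six.trans_lt (by norm_num))
    simp only [Finset.mem_insert, Finset.mem_singleton, not_or] at hhn
    obtain ⟨k, hk, hkp⟩ := hpart b hb h hh (Ne.symm hbn) (Ne.symm hhn.1) (Ne.symm hhn.2.1)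
    have uniq : ∀ x y z w, col b x y → col b z w → x ≠ z → x ≠ w → y ≠ z ∧ y ≠ w := by
      intro x y z w hxy hzw hxz hxw
      constructor
      · rintro rfl
        exact hxw (h4 _ _ _ _ (h2 _ _ _ hxy) hzw)
      · rintro rfl
        exact hxz (h4 _ _ _ _ (h2 _ _ _ hxy) (h2 _ _ _ hzw))
    have u1 := uniq f g d e hg he hfn.2.2.1 hfn.2.2.2
    have u2 := uniq h k d e hk he hhn.2.2.1 hhn.2.2.2.1
    have u3 := uniq h k f g hk hg hhn.2.2.2.2.1 hhn.2.2.2.2.2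
    have me := hm2 _ _ _ he
    have mg := hm2 _ _ _ hg
    have mk := hm2 _ _ _ hk
    have hn : [p, b, d, e, f, g, h, k].Nodup := by
      simp only [List.nodup_cons, List.mem_cons, List.not_mem_nil]
      clear H' ext h33 hF h4 h1 h2 hmem hm2 uniq hpart hord hA
      grind
    have hle := Finset.card_le_card (s := [p, b, d, e, f, g, h, k].toFinset) (t := S) (by
      intro w hw
      simp only [List.mem_toFinset, List.mem_cons, List.not_mem_nil, or_false] at hw
      rcases hw with rfl | rfl | rfl | rfl | rfl | rfl | rfl | rfl
      exacts [hp, hb, hd, me.2.1, hf, mg.2.1, hh, mk.2.1])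
    rw [List.toFinset_card_of_nodup hn, hS] at hle
    simp at hle

/-! ### Values and continuity of `½ log (|P|² + |Q|²)`. -/

/-- The function `½ log (|P|² + |Q|²)` attached to two polynomials. -/
noncomputable def halfLogNormSq {n : ℕ} (P Q : MvPolynomial (Fin n) ℂ)
    (z : EuclideanSpace ℂ (Fin n)) : EReal :=
  ((1 / 2 : ℝ) : EReal) *
    ENNReal.log (‖MvPolynomial.eval (fun i => z i) P‖ₑ ^ 2 +
      ‖MvPolynomial.eval (fun i => z i) Q‖ₑ ^ 2)

section
variable {n : ℕ} {P Q : MvPolynomial (Fin n) ℂ} {z : EuclideanSpace ℂ (Fin n)}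

theorem enorm_sq_add_enorm_sq (a b : ℂ) :
    ‖a‖ₑ ^ 2 + ‖b‖ₑ ^ 2 = ENNReal.ofReal (‖a‖ ^ 2 + ‖b‖ ^ 2) := by
  rw [ENNReal.ofReal_add (by positivity) (by positivity), ENNReal.ofReal_pow (norm_nonneg _),
    ENNReal.ofReal_pow (norm_nonneg _), ofReal_norm, ofReal_norm]

theorem halfLogNormSq_eq_coe
    (h : 0 < ‖MvPolynomial.eval (fun i => z i) P‖ ^ 2 + ‖MvPolynomial.eval (fun i => z i) Q‖ ^ 2) :
    halfLogNormSq P Q z = ((1 / 2 * Real.log (‖MvPolynomial.eval (fun i => z i) P‖ ^ 2 +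
      ‖MvPolynomial.eval (fun i => z i) Q‖ ^ 2) : ℝ) : EReal) := by
  rw [halfLogNormSq, enorm_sq_add_enorm_sq, ENNReal.log_ofReal_of_pos h, EReal.coe_mul]

theorem halfLogNormSq_eq_bot (hP : MvPolynomial.eval (fun i => z i) P = 0)
    (hQ : MvPolynomial.eval (fun i => z i) Q = 0) : halfLogNormSq P Q z = ⊥ := by
  rw [halfLogNormSq, hP, hQ]
  simp [EReal.coe_mul_bot_of_pos]

theorem norm_sq_add_norm_sq_pos_or_eq_zero (a b : ℂ) : 0 < ‖a‖ ^ 2 + ‖b‖ ^ 2 ∨ a = 0 ∧ b = 0 := by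
  by_cases ha : a = 0
  · by_cases hb : b = 0
    · exact Or.inr ⟨ha, hb⟩
    · left; positivity
  · left; positivity

theorem halfLogNormSq_lt_top : halfLogNormSq P Q z < ⊤ := by
  rcases norm_sq_add_norm_sq_pos_or_eq_zero (MvPolynomial.eval (fun i => z i) P)
    (MvPolynomial.eval (fun i => z i) Q) with h | ⟨h, h'⟩
  · rw [halfLogNormSq_eq_coe h]; exact EReal.coe_lt_top _
  · rw [halfLogNormSq_eq_bot h h']; exact bot_lt_top

theorem continuous_eval_euclidean (P : MvPolynomial (Fin n) ℂ) :
    Continuous fun z : EuclideanSpace ℂ (Fin n) => MvPolynomial.eval (fun i => z i) P :=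
  (MvPolynomial.continuous_eval P).comp (by fun_prop)

theorem continuous_halfLogNormSq (P Q : MvPolynomial (Fin n) ℂ) :
    Continuous (halfLogNormSq P Q) := by
  have h : Continuous fun z : EuclideanSpace ℂ (Fin n) =>
      ENNReal.log (‖MvPolynomial.eval (fun i => z i) P‖ₑ ^ 2 +
        ‖MvPolynomial.eval (fun i => z i) Q‖ₑ ^ 2) := by
    refine ENNReal.continuous_log.comp ?_
    have hP := (continuous_eval_euclidean P).enorm
    have hQ := (continuous_eval_euclidean Q).enorm
    exact ((ENNReal.continuous_pow 2).comp hP).add ((ENNReal.continuous_pow 2).comp hQ)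
  rw [continuous_iff_continuousAt]
  intro z
  have := (EReal.continuousAt_mul (p := (((1 / 2 : ℝ) : EReal),
    ENNReal.log (‖MvPolynomial.eval (fun i => z i) P‖ₑ ^ 2 +
        ‖MvPolynomial.eval (fun i => z i) Q‖ₑ ^ 2))) (Or.inl (by norm_num))
          (Or.inl (by norm_num))
          (Or.inl (EReal.coe_ne_bot _)) (Or.inl (EReal.coe_ne_top _)))
  exact ContinuousAt.comp (f := fun z : EuclideanSpace ℂ (Fin n) => (((1 / 2 : ℝ) : EReal),
    ENNReal.log (‖MvPolynomial.eval (fun i => z i) P‖ₑ ^ 2 +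
        ‖MvPolynomial.eval (fun i => z i) Q‖ₑ ^ 2))) this
        (continuousAt_const.prodMk h.continuousAt)

theorem analyticAt_eval_line (P : MvPolynomial (Fin n) ℂ) (a b : EuclideanSpace ℂ (Fin n)) (ζ : ℂ) :
    AnalyticAt ℂ (fun ζ : ℂ => MvPolynomial.eval (fun i => (a + ζ • b) i) P) ζ := by
  have := AnalyticAt.aeval_mvPolynomial (𝕜 := ℂ) (f := fun (ζ : ℂ) i => (a + ζ • b) i) (z := ζ)
    (fun i => (analyticAt_const (v := a i)).add
      (analyticAt_id.mul (analyticAt_const (v := b i)))) P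
  simpa [MvPolynomial.coe_aeval_eq_eval] using this

end

/-! ### Angular means and plurisubharmonicity. -/

/-- The almost-everywhere form is needed because comparison functions such as `Real.log ‖H‖` have
the meaningless value `0` at zeros of `H`. -/
theorem angularMean_mono_ae {f g : ℝ → EReal}
    (h : ∀ᵐ θ ∂(volume.restrict (Ioc 0 (2 * Real.pi))), f θ ≤ g θ) :
    angularMean f ≤ angularMean g := by
  unfold angularMean
  refine EReal.sub_le_sub ?_ ?_
  · rw [EReal.coe_ennreal_le_coe_ennreal_iff, laverage_eq, laverage_eq]
    gcongr ?_ / _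
    refine lintegral_mono_ae (h.mono fun θ hθ => EReal.toENNReal_le_toENNReal hθ)
  · rw [EReal.coe_ennreal_le_coe_ennreal_iff, laverage_eq, laverage_eq]
    gcongr ?_ / _
    refine lintegral_mono_ae (h.mono fun θ hθ => EReal.toENNReal_le_toENNReal
      (EReal.neg_le_neg_iff.2 hθ))

theorem angularMean_coe {g : ℝ → ℝ} (hg : IntegrableOn g (Ioc 0 (2 * Real.pi))) :
    angularMean (fun θ => (g θ : EReal)) =
      (((2 * Real.pi)⁻¹ * ∫ θ in (0)..(2 * Real.pi), g θ : ℝ) : EReal) := by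
  have hpi : 0 < 2 * Real.pi := by positivity
  have hneg : ∀ θ, (-(g θ : EReal)).toENNReal = ENNReal.ofReal (-g θ) := by
    intro θ
    rw [← EReal.coe_neg, EReal.toENNReal_of_ne_top (EReal.coe_ne_top _), EReal.toReal_coe]
  have hpos : ∀ θ, (g θ : EReal).toENNReal = ENNReal.ofReal (g θ) := by
    intro θ
    rw [EReal.toENNReal_of_ne_top (EReal.coe_ne_top _), EReal.toReal_coe]
  have f1 : ∫⁻ θ in Ioc 0 (2 * Real.pi), ENNReal.ofReal (g θ) ≠ ⊤ :=
    ((lintegral_ofReal_le_lintegral_enorm _).trans_lt hg.2).ne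
  have f2 : ∫⁻ θ in Ioc 0 (2 * Real.pi), ENNReal.ofReal (-g θ) ≠ ⊤ :=
    ((lintegral_ofReal_le_lintegral_enorm _).trans_lt hg.neg.2).ne
  unfold angularMean
  simp_rw [hneg, hpos, laverage_eq]
  rw [intervalIntegral.integral_of_le hpi.le, integral_eq_lintegral_pos_part_sub_lintegral_neg_part hg]
  have hv : (volume.restrict (Ioc 0 (2 * Real.pi))) univ = ENNReal.ofReal (2 * Real.pi) := by simp
  rw [hv, mul_sub, EReal.coe_sub]
  have key : ∀ x : ENNReal, x ≠ ⊤ → ((x / ENNReal.ofReal (2 * Real.pi) : ENNReal) : EReal) =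
      (((2 * Real.pi)⁻¹ * x.toReal : ℝ) : EReal) := by
    intro x hx
    have hne : x / ENNReal.ofReal (2 * Real.pi) ≠ ⊤ :=
      ENNReal.div_ne_top hx (by simpa using Real.pi_pos)
    rw [← EReal.coe_toReal (x := ((x / ENNReal.ofReal (2 * Real.pi) : ENNReal) : EReal))
      (by simpa using hne) (by simp), EReal.toReal_coe_ennreal, ENNReal.toReal_div,
      ENNReal.toReal_ofReal hpi.le, div_eq_inv_mul]
  rw [key _ f1, key _ f2]

theorem angularMean_coe_circle {F : ℂ → ℝ} (hF : CircleIntegrable F 0 1) :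
    angularMean (fun θ => (F (Complex.exp (θ * Complex.I)) : EReal)) =
      ((Real.circleAverage F 0 1 : ℝ) : EReal) := by
  have h : ∀ θ : ℝ, Complex.exp (θ * Complex.I) = circleMap 0 1 θ := fun θ => by simp [circleMap]
  simp_rw [h]
  rw [angularMean_coe (g := fun θ => F (circleMap 0 1 θ))]
  · rw [Real.circleAverage, smul_eq_mul]
  · have := hF
    rw [CircleIntegrable, intervalIntegrable_iff_integrableOn_Ioc_of_le (by positivity)] at this
    exact this

open Real in
/-- The sub-mean value inequality for `log |h|`. -/
theorem log_norm_le_circleAverage {h : ℂ → ℂ} (hh : AnalyticOnNhd ℂ h (Metric.closedBall 0 1))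
    (h0 : h 0 ≠ 0) : Real.log ‖h 0‖ ≤ circleAverage (fun ζ => Real.log ‖h ζ‖) 0 1 := by
  have e := AnalyticOnNhd.circleAverage_log_norm (c := 0) (R := 1) one_ne_zero (by simpa using hh) h0
  rw [e]
  -- By Jensen's formula the mean exceeds the central value by a sum over the zeros `u` in the disc
  -- of multiplicity times `log (1 / |u|)`, which is nonnegative.
  have : 0 ≤ ∑ᶠ u, (MeromorphicOn.divisor h (Metric.closedBall 0 |1|) u : ℝ) *
      Real.log (1 * ‖0 - u‖⁻¹) := by
    refine finsum_nonneg fun u => ?_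
    by_cases hu : u ∈ Metric.closedBall (0 : ℂ) |1|
    · have hh' : AnalyticOnNhd ℂ h (Metric.closedBall 0 |1|) := by simpa using hh
      refine mul_nonneg (by exact_mod_cast (MeromorphicOn.AnalyticOnNhd.divisor_nonneg hh') u) ?_
      have hu1 : ‖u‖ ≤ 1 := by simpa using hu
      by_cases hu0 : u = 0
      · simp [hu0]
      · apply Real.log_nonneg
        rw [one_mul, zero_sub, norm_neg]
        exact (one_le_inv₀ (norm_pos_iff.2 hu0)).2 hu1
    · rw [Function.locallyFinsuppWithin.apply_eq_zero_of_notMem _ hu]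
      simp
  linarith

/-- Lagrange's identity. -/
theorem lagrange_norm_sq (f₀ g₀ f g : ℂ) :
    ‖(starRingEnd ℂ) f₀ * f + (starRingEnd ℂ) g₀ * g‖ ^ 2 + ‖f₀ * g - g₀ * f‖ ^ 2 =
      (‖f₀‖ ^ 2 + ‖g₀‖ ^ 2) * (‖f‖ ^ 2 + ‖g‖ ^ 2) := by
  simp only [← Complex.normSq_eq_norm_sq, Complex.normSq_apply]
  simp
  ring

/-- With `f₀, g₀` the values of `P, Q` at `a` and `H = conj f₀ · P + conj g₀ · Q`, Cauchy–Schwarz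
gives `u ≥ log |H| - ½ log (|f₀|² + |g₀|²)` on the disc, with equality at the centre. The sub-mean
value inequality for `log |H|` therefore passes to `u`. -/
theorem plurisubharmonicOn_halfLogNormSq {n : ℕ} (P Q : MvPolynomial (Fin n) ℂ)
    (D : Set (EuclideanSpace ℂ (Fin n))) : PlurisubharmonicOn (halfLogNormSq P Q) D where
  lt_top _ _ := halfLogNormSq_lt_top
  usc := (continuous_halfLogNormSq P Q).continuousOn.upperSemicontinuousOn
  le_mean a b _ := by
    rcases norm_sq_add_norm_sq_pos_or_eq_zero (MvPolynomial.eval (fun i => a i) P)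
      (MvPolynomial.eval (fun i => a i) Q) with h | ⟨h, h'⟩
    swap
    · rw [halfLogNormSq_eq_bot h h']; exact bot_le
    set f₀ := MvPolynomial.eval (fun i => a i) P
    set g₀ := MvPolynomial.eval (fun i => a i) Q
    let H : ℂ → ℂ := fun ζ =>
      (starRingEnd ℂ) f₀ * MvPolynomial.eval (fun i => (a + ζ • b) i) P +
        (starRingEnd ℂ) g₀ * MvPolynomial.eval (fun i => (a + ζ • b) i) Q
    have hHa : ∀ ζ, AnalyticAt ℂ H ζ := fun ζ =>
      (analyticAt_const.mul (analyticAt_eval_line P a b ζ)).add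
        (analyticAt_const.mul (analyticAt_eval_line Q a b ζ))
    have hH0 : H 0 = ((‖f₀‖ ^ 2 + ‖g₀‖ ^ 2 : ℝ) : ℂ) := by
      simp only [H, zero_smul, add_zero]
      rw [mul_comm, Complex.mul_conj', mul_comm, Complex.mul_conj']
      push_cast
      rfl
    have hH0' : H 0 ≠ 0 := by rw [hH0]; exact_mod_cast h.ne'
    have hmer : MeromorphicOn H (Metric.sphere 0 |1|) := fun ζ _ => (hHa ζ).meromorphicAt
    have hint := hmer.circleIntegrable_log_norm
    let F : ℂ → ℝ := fun ζ => Real.log ‖H ζ‖ + -(1 / 2 * Real.log (‖f₀‖ ^ 2 + ‖g₀‖ ^ 2))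
    have hF : CircleIntegrable F 0 1 := hint.add (circleIntegrable_const _ _ _)
    have hFavg : Real.circleAverage F 0 1 = Real.circleAverage (fun ζ => Real.log ‖H ζ‖) 0 1 +
        -(1 / 2 * Real.log (‖f₀‖ ^ 2 + ‖g₀‖ ^ 2)) := by
      have := Real.circleAverage_add hint
        (circleIntegrable_const (-(1 / 2 * Real.log (‖f₀‖ ^ 2 + ‖g₀‖ ^ 2))) 0 1)
      rw [Real.circleAverage_const] at this
      exact this
    have hle := log_norm_le_circleAverage (fun ζ _ => hHa ζ) hH0'
    have hnorm : ‖H 0‖ = ‖f₀‖ ^ 2 + ‖g₀‖ ^ 2 := by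
      rw [hH0, Complex.norm_real, Real.norm_of_nonneg h.le]
    calc halfLogNormSq P Q a = ((1 / 2 * Real.log (‖f₀‖ ^ 2 + ‖g₀‖ ^ 2) : ℝ) : EReal) :=
          halfLogNormSq_eq_coe h
      _ ≤ ((Real.circleAverage F 0 1 : ℝ) : EReal) := by
          rw [EReal.coe_le_coe_iff, hFavg]
          rw [hnorm] at hle
          linarith
      _ = angularMean (fun θ => (F (Complex.exp (θ * Complex.I)) : EReal)) :=
          (angularMean_coe_circle hF).symm
      _ ≤ _ := by
          apply angularMean_mono_ae
          -- At a zero of `H` the convention `Real.log 0 = 0` may break `F ≤ u`. As `H` is analytic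
          -- and not identically zero, this concerns only a null set of angles.
          have hne : ∀ᵐ θ : ℝ, H (Complex.exp (θ * Complex.I)) ≠ 0 := by
            have hcod : H ⁻¹' {0}ᶜ ∈ Filter.codiscrete ℂ :=
              AnalyticOnNhd.preimage_zero_mem_codiscrete (fun ζ _ => hHa ζ) hH0'
            have h2 := circleMap_preimage_codiscrete (c := 0) (R := 1) one_ne_zero
              (Filter.codiscreteWithin_mono (Set.subset_univ (Metric.sphere (0 : ℂ) |1|)) hcod)
            have h3 := ae_restrict_le_codiscreteWithin (μ := (volume : Measure ℝ))
              MeasurableSet.univ h2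
            rw [Measure.restrict_univ] at h3
            filter_upwards [h3] with θ hθ
            simpa [circleMap] using hθ
          filter_upwards [ae_restrict_of_ae hne] with θ hθ
          have hlag := lagrange_norm_sq f₀ g₀
            (MvPolynomial.eval (fun i => (a + Complex.exp (θ * Complex.I) • b) i) P)
            (MvPolynomial.eval (fun i => (a + Complex.exp (θ * Complex.I) • b) i) Q)
          have hpos : 0 < ‖H (Complex.exp (θ * Complex.I))‖ := norm_pos_iff.2 hθ
          have hle2 : ‖H (Complex.exp (θ * Complex.I))‖ ^ 2 ≤ (‖f₀‖ ^ 2 + ‖g₀‖ ^ 2) *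
            (‖MvPolynomial.eval (fun i => (a + Complex.exp (θ * Complex.I) • b) i) P‖ ^ 2 +
              ‖MvPolynomial.eval (fun i => (a + Complex.exp (θ * Complex.I) • b) i) Q‖ ^ 2) := by
            rw [← hlag]
            exact le_add_of_nonneg_right (by positivity)
          have hpos2 := pos_of_mul_pos_right ((pow_pos hpos 2).trans_le hle2) h.le
          rw [halfLogNormSq_eq_coe hpos2, EReal.coe_le_coe_iff]
          have := Real.log_le_log (pow_pos hpos 2) hle2
          rw [Real.log_mul h.ne' hpos2.ne', Real.log_pow] at this
          push_cast at this
          simp only [F]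
          linarith

/-! ### Maximality of `½ log (|P|² + |Q|²)` in dimension two. -/

theorem analyticAt_eval_euclidean {n : ℕ} (P : MvPolynomial (Fin n) ℂ)
    (z : EuclideanSpace ℂ (Fin n)) :
    AnalyticAt ℂ (fun z : EuclideanSpace ℂ (Fin n) => MvPolynomial.eval (fun i => z i) P) z := by
  have := AnalyticAt.aeval_mvPolynomial (𝕜 := ℂ)
    (f := fun (z : EuclideanSpace ℂ (Fin n)) i => z i) (z := z)
    (fun i => (EuclideanSpace.proj (𝕜 := ℂ) i).analyticAt z) P
  simpa [MvPolynomial.coe_aeval_eq_eval] using this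

/-- A differentiable function on `ℂ²` has a critical direction at every point. -/
theorem exists_ne_zero_hasDerivAt_line_zero {K : EuclideanSpace ℂ (Fin 2) → ℂ}
    {z : EuclideanSpace ℂ (Fin 2)} (hK : DifferentiableAt ℂ K z) :
    ∃ b : EuclideanSpace ℂ (Fin 2), b ≠ 0 ∧ HasDerivAt (fun ζ : ℂ => K (z + ζ • b)) 0 0 := by
  -- A linear form on a two-dimensional space has a nonzero kernel.
  have hker : LinearMap.ker (fderiv ℂ K z).toLinearMap ≠ ⊥ :=
    LinearMap.ker_ne_bot_of_finrank_lt (by simp)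
  obtain ⟨b, hb, hb0⟩ := Submodule.exists_mem_ne_zero_of_ne_bot hker
  refine ⟨b, hb0, ?_⟩
  have hline : HasDerivAt (fun ζ : ℂ => z + ζ • b) b 0 := by
    simpa using ((hasDerivAt_id (0 : ℂ)).smul_const b).const_add z
  have hK' : HasFDerivAt K (fderiv ℂ K z) (z + (0 : ℂ) • b) := by simpa using hK.hasFDerivAt
  have := hK'.comp_hasDerivAt (0 : ℂ) hline
  have hb' : fderiv ℂ K z b = 0 := hb
  rwa [hb'] at this

/-- An entire function with a double zero at the origin is `O(|ζ|²)`. -/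
theorem exists_norm_le_sq_of_hasDerivAt_zero {k : ℂ → ℂ} (hk : Differentiable ℂ k) (h0 : k 0 = 0)
    (hd : HasDerivAt k 0 0) :
    ∃ C > 0, ∃ r > 0, ∀ ζ : ℂ, ‖ζ‖ ≤ r → ‖k ζ‖ ≤ C * ‖ζ‖ ^ 2 := by
  -- Here `k ζ = ζ * dslope k 0 ζ`, and the second factor is differentiable and vanishes at `0`,
  -- hence is itself `O(|ζ|)`.
  have hs : DifferentiableAt ℂ (dslope k 0) 0 :=
    ((Complex.differentiableOn_dslope (s := univ) univ_mem).2 hk.differentiableOn).differentiableAt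
      univ_mem
  have hO := hs.isBigO_sub
  obtain ⟨C, hC, hO⟩ := hO.exists_pos
  obtain ⟨r, hr, hball⟩ := Metric.eventually_nhds_iff_ball.1 hO.bound
  refine ⟨C, hC, r / 2, by positivity, fun ζ hζ => ?_⟩
  have := hball ζ (by simpa using lt_of_le_of_lt hζ (by linarith))
  rw [dslope_same, hd.deriv, sub_zero, sub_zero] at this
  have e := sub_smul_dslope k 0 ζ
  rw [h0, sub_zero, sub_zero, smul_eq_mul] at e
  rw [← e, norm_mul]
  nlinarith [norm_nonneg ζ]

/-- Through every point which is not a common zero of `P` and `Q` there is a complex line on which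
`½ log (|P|² + |Q|²)` is harmonic up to terms of fourth order. -/
theorem exists_line_halfLogNormSq_le {P Q : MvPolynomial (Fin 2) ℂ} {z : EuclideanSpace ℂ (Fin 2)}
    (h : 0 < ‖MvPolynomial.eval (fun i => z i) P‖ ^ 2 +
      ‖MvPolynomial.eval (fun i => z i) Q‖ ^ 2) :
    ∃ b : EuclideanSpace ℂ (Fin 2), b ≠ 0 ∧ ∃ C : ℝ, ∃ r₀ > 0, ∀ r : ℝ, 0 < r → r ≤ r₀ →
      ∃ F : ℂ → ℝ, CircleIntegrable F 0 1 ∧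
        Real.circleAverage F 0 1 = 1 / 2 * Real.log (‖MvPolynomial.eval (fun i => z i) P‖ ^ 2 +
          ‖MvPolynomial.eval (fun i => z i) Q‖ ^ 2) + C * r ^ 4 ∧
        ∀ ζ : ℂ, ‖ζ‖ = 1 →
          1 / 2 * Real.log (‖MvPolynomial.eval (fun i => (z + ζ • ((r : ℂ) • b)) i) P‖ ^ 2 +
            ‖MvPolynomial.eval (fun i => (z + ζ • ((r : ℂ) • b)) i) Q‖ ^ 2) ≤ F ζ := by
  set f₀ := MvPolynomial.eval (fun i => z i) P
  set g₀ := MvPolynomial.eval (fun i => z i) Q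
  set N := ‖f₀‖ ^ 2 + ‖g₀‖ ^ 2
  -- The function `f₀ Q - g₀ P` is the remainder in Lagrange's identity. It vanishes at `z`, and `b`
  -- is a direction in which it vanishes to second order.
  obtain ⟨b, hb, hd⟩ := exists_ne_zero_hasDerivAt_line_zero
    (K := fun w => f₀ * MvPolynomial.eval (fun i => w i) Q - g₀ * MvPolynomial.eval (fun i => w i) P)
    (z := z) (((analyticAt_eval_euclidean Q z).differentiableAt.const_mul _).sub
      ((analyticAt_eval_euclidean P z).differentiableAt.const_mul _))
  set k : ℂ → ℂ := fun ζ => f₀ * MvPolynomial.eval (fun i => (z + ζ • b) i) Q -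
    g₀ * MvPolynomial.eval (fun i => (z + ζ • b) i) P with hk
  have hkd : Differentiable ℂ k := fun ζ =>
    ((analyticAt_eval_line Q z b ζ).differentiableAt.const_mul _).sub
      ((analyticAt_eval_line P z b ζ).differentiableAt.const_mul _)
  obtain ⟨C, hC, r₁, hr₁, hkle⟩ := exists_norm_le_sq_of_hasDerivAt_zero hkd
    (by simp only [hk, zero_smul, add_zero]; exact sub_eq_zero.2 (mul_comm _ _)) hd
  let H : ℂ → ℂ := fun ζ =>
    (starRingEnd ℂ) f₀ * MvPolynomial.eval (fun i => (z + ζ • b) i) P +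
      (starRingEnd ℂ) g₀ * MvPolynomial.eval (fun i => (z + ζ • b) i) Q
  have hHa : ∀ ζ, AnalyticAt ℂ H ζ := fun ζ =>
    (analyticAt_const.mul (analyticAt_eval_line P z b ζ)).add
      (analyticAt_const.mul (analyticAt_eval_line Q z b ζ))
  have hH0 : H 0 = (N : ℂ) := by
    simp only [H, zero_smul, add_zero, N]
    rw [mul_comm, Complex.mul_conj', mul_comm, Complex.mul_conj']
    push_cast
    rfl
  have hH0' : ‖H 0‖ = N := by rw [hH0, Complex.norm_real, Real.norm_of_nonneg h.le]
  obtain ⟨r₂, hr₂, hHge⟩ : ∃ r > 0, ∀ ζ : ℂ, ‖ζ‖ < r → N / 2 < ‖H ζ‖ := by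
    have : ∀ᶠ ζ in 𝓝 (0 : ℂ), N / 2 < ‖H ζ‖ :=
      ((hHa 0).continuousAt.norm).eventually_const_lt
        (show N / 2 < ‖H 0‖ by rw [hH0']; linarith)
    obtain ⟨r, hr, hb⟩ := Metric.eventually_nhds_iff_ball.1 this
    exact ⟨r, hr, fun ζ hζ => hb ζ (by simpa using hζ)⟩
  -- Up to the constant `-½ log N`, the function is `log |H| + ½ log (1 + |k / H|²)`. From `|k| ≤ C
  -- r²` and `|H| > N / 2` the last term is at most `½ (2 C r² / N)²`. The radius is small enough
  -- for both bounds.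
  refine ⟨b, hb, 1 / 2 * (C ^ 2 * (4 / N ^ 2)), min r₁ (r₂ / 2), by positivity, fun r hr hrle => ?_⟩
  have hr1 : r ≤ r₁ := hrle.trans (min_le_left _ _)
  have hr2 : r < r₂ := (hrle.trans (min_le_right _ _)).trans_lt (by linarith)
  have hHr : ∀ ζ : ℂ, AnalyticAt ℂ (fun ζ : ℂ => H (ζ * r)) ζ := fun ζ =>
    (hHa (ζ * r)).comp_of_eq (f := fun ζ : ℂ => ζ * r) (by fun_prop) rfl
  have hnr : ∀ ζ : ℂ, ‖ζ‖ ≤ 1 → ‖ζ * r‖ ≤ r := fun ζ hζ => by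
    rw [norm_mul, Complex.norm_real, Real.norm_of_nonneg hr.le]
    nlinarith
  have hHrn : ∀ ζ : ℂ, ‖ζ‖ ≤ 1 → N / 2 < ‖H (ζ * r)‖ := fun ζ hζ =>
    hHge _ ((hnr ζ hζ).trans_lt hr2)
  set c : ℝ := -(1 / 2 * Real.log N) + 1 / 2 * (C ^ 2 * (4 / N ^ 2)) * r ^ 4 with hc
  have hmer : MeromorphicOn (fun ζ : ℂ => H (ζ * r)) (Metric.sphere 0 |1|) :=
    fun ζ _ => (hHr ζ).meromorphicAt
  have hint := hmer.circleIntegrable_log_norm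
  refine ⟨fun ζ => Real.log ‖H (ζ * r)‖ + c, hint.add (circleIntegrable_const _ _ _), ?_, ?_⟩
  -- As `H` has no zeros on the closed disc, `log |H|` is harmonic there and its mean is exactly
  -- `log N`.
  · have h1 := Real.circleAverage_add hint (circleIntegrable_const c 0 1)
    rw [Real.circleAverage_const, AnalyticOnNhd.circleAverage_log_norm_of_ne_zero
      (fun ζ _ => hHr ζ) (fun ζ hζ => by
        have := hHrn ζ (by simpa using hζ)
        exact norm_pos_iff.1 (lt_trans (by positivity) this)), zero_mul, hH0'] at h1
    refine Eq.trans h1 ?_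
    rw [hc]
    ring
  · intro ζ hζ
    have hsm : ζ • ((r : ℂ) • b) = (ζ * r) • b := by rw [smul_smul]
    rw [hsm]
    have hlag := lagrange_norm_sq f₀ g₀ (MvPolynomial.eval (fun i => (z + (ζ * r) • b) i) P)
      (MvPolynomial.eval (fun i => (z + (ζ * r) • b) i) Q)
    change ‖H (ζ * r)‖ ^ 2 + ‖k (ζ * r)‖ ^ 2 = N * _ at hlag
    set M := ‖MvPolynomial.eval (fun i => (z + (ζ * r) • b) i) P‖ ^ 2 +
      ‖MvPolynomial.eval (fun i => (z + (ζ * r) • b) i) Q‖ ^ 2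
    have hHp := hHrn ζ hζ.le
    have hHpos : 0 < ‖H (ζ * r)‖ := lt_trans (by positivity) hHp
    have hMpos : 0 < M := by
      refine pos_of_mul_pos_right (a := N) ?_ h.le
      rw [← hlag]
      positivity
    have hkr : ‖k (ζ * r)‖ ≤ C * r ^ 2 := by
      refine (hkle _ ((hnr ζ hζ.le).trans hr1)).trans ?_
      gcongr
      exact hnr ζ hζ.le
    have hfac : N * M = ‖H (ζ * r)‖ ^ 2 * (1 + (‖k (ζ * r)‖ / ‖H (ζ * r)‖) ^ 2) := by
      rw [← hlag]; field_simp
    have hlog := congrArg Real.log hfac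
    rw [Real.log_mul h.ne' hMpos.ne', Real.log_mul (by positivity) (by positivity),
      Real.log_pow] at hlog
    have hquot : (‖k (ζ * r)‖ / ‖H (ζ * r)‖) ^ 2 ≤ C ^ 2 * (4 / N ^ 2) * r ^ 4 := by
      have : ‖k (ζ * r)‖ / ‖H (ζ * r)‖ ≤ C * r ^ 2 / (N / 2) := by gcongr
      calc _ ≤ (C * r ^ 2 / (N / 2)) ^ 2 := by gcongr
        _ = _ := by field_simp; ring
    have hl1 := Real.log_le_sub_one_of_pos
      (show 0 < 1 + (‖k (ζ * r)‖ / ‖H (ζ * r)‖) ^ 2 by positivity)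
    push_cast at hlog
    rw [hc]
    linarith

theorem circleAverage_re_mul_const (c : ℂ) : Real.circleAverage (fun ζ => (ζ * c).re) 0 1 = 0 := by
  have := InnerProductSpace.HarmonicOnNhd.circleAverage_eq (f := fun ζ : ℂ => (ζ * c).re)
    (c := 0) (R := 1) (fun ζ _ => AnalyticAt.harmonicAt_re (f := fun ζ => ζ * c) (by fun_prop))
  simpa using this

/-- The mean of the squared norm over a circle in a complex line. -/
theorem circleAverage_norm_sq {n : ℕ} (z b : EuclideanSpace ℂ (Fin n)) :
    Real.circleAverage (fun ζ => ‖z + ζ • b‖ ^ 2) 0 1 = ‖z‖ ^ 2 + ‖b‖ ^ 2 := by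
  have h1 : CircleIntegrable (fun ζ : ℂ => 2 * (ζ * inner ℂ z b).re) 0 1 :=
    ContinuousOn.circleIntegrable' (by fun_prop)
  have h := Real.circleAverage_add (circleIntegrable_const (‖z‖ ^ 2 + ‖b‖ ^ 2) 0 1) h1
  have h2 : Real.circleAverage (fun ζ : ℂ => 2 * (ζ * inner ℂ z b).re) 0 1 = 0 := by
    have := circleAverage_re_mul_const (2 * inner ℂ z b)
    rw [← this]
    congr 1
    ext ζ
    simp
    ring
  rw [Real.circleAverage_const, h2, add_zero] at h
  rw [← h]
  refine Real.circleAverage_congr_sphere fun ζ hζ => ?_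
  have hζ : ‖ζ‖ = 1 := by simpa using hζ
  simp only [Pi.add_apply]
  rw [@norm_add_sq ℂ, norm_smul, hζ, inner_smul_right]
  simp
  ring

theorem upperSemicontinuousOn_add_coe {X : Type*} [TopologicalSpace X] {s : Set X} {v : X → EReal}
    (hv : UpperSemicontinuousOn v s) {g : X → ℝ} (hg : ContinuousOn g s) :
    UpperSemicontinuousOn (fun x => v x + (g x : EReal)) s :=
  hv.add' (continuous_coe_real_ereal.comp_continuousOn hg).upperSemicontinuousOn
    fun _ _ => EReal.continuousAt_add (Or.inr (EReal.coe_ne_bot _)) (Or.inr (EReal.coe_ne_top _))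

/-- `½ log (|P|² + |Q|²)` is maximal off the common zeros of `P` and `Q`. -/
theorem isMaximalPSHOn_halfLogNormSq {P Q : MvPolynomial (Fin 2) ℂ}
    {D : Set (EuclideanSpace ℂ (Fin 2))}
    (hD : ∀ z ∈ D, 0 < ‖MvPolynomial.eval (fun i => z i) P‖ ^ 2 +
      ‖MvPolynomial.eval (fun i => z i) Q‖ ^ 2) : IsMaximalPSHOn (halfLogNormSq P Q) D where
  psh := plurisubharmonicOn_halfLogNormSq P Q D
  le_of_le_frontier G v hG hGc hGD hvusc hv hfr z₁ hz₁ := by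
    by_contra! hlt
    set N : EuclideanSpace ℂ (Fin 2) → ℝ := fun z => ‖MvPolynomial.eval (fun i => z i) P‖ ^ 2 +
      ‖MvPolynomial.eval (fun i => z i) Q‖ ^ 2 with hN
    set U : EuclideanSpace ℂ (Fin 2) → ℝ := fun z => 1 / 2 * Real.log (N z) with hU
    have hu : ∀ z ∈ closure G, halfLogNormSq P Q z = (U z : EReal) := fun z hz =>
      halfLogNormSq_eq_coe (hD z (hGD hz))
    have hNc : Continuous N := by
      have hP := continuous_eval_euclidean P
      have hQ := continuous_eval_euclidean Q
      fun_prop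
    have hUc : ContinuousOn U (closure G) :=
      continuousOn_const.mul (hNc.continuousOn.log fun z hz => (hD z (hGD hz)).ne')
    obtain ⟨R, hR⟩ := hGc.isBounded.exists_norm_le
    have hR0 : 0 ≤ R := (norm_nonneg _).trans (hR z₁ (subset_closure hz₁))
    rw [hu _ (subset_closure hz₁)] at hlt
    obtain ⟨V₁, hV₁⟩ : ∃ V : ℝ, v z₁ = V :=
      ⟨(v z₁).toReal, (EReal.coe_toReal (hv.lt_top _ hz₁).ne (bot_le.trans_lt hlt).ne').symm⟩
    rw [hV₁, EReal.coe_lt_coe_iff] at hlt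
    -- With this `ε` the function `v - u + ε‖z‖²` exceeds `ε R²` at `z₁`, whereas it is at most `ε
    -- R²` on the boundary. Its maximum over the closure is therefore attained at a point of `G`.
    obtain ⟨ε, hε, hεlt⟩ : ∃ ε > 0, ε * R ^ 2 < V₁ - U z₁ := by
      refine ⟨(V₁ - U z₁) / (2 * (R ^ 2 + 1)), div_pos (by linarith) (by positivity), ?_⟩
      rw [div_mul_eq_mul_div, div_lt_iff₀ (by positivity)]
      nlinarith [sq_nonneg R]
    set g : EuclideanSpace ℂ (Fin 2) → ℝ := fun z => ε * ‖z‖ ^ 2 - U z with hg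
    have hgc : ContinuousOn g (closure G) := by
      have : Continuous fun z : EuclideanSpace ℂ (Fin 2) => ε * ‖z‖ ^ 2 := by fun_prop
      exact this.continuousOn.sub hUc
    obtain ⟨z₀, hz₀, hmax⟩ := UpperSemicontinuousOn.exists_isMaxOn ⟨z₁, subset_closure hz₁⟩ hGc
      (upperSemicontinuousOn_add_coe hvusc hgc)
    have hmax : ∀ z ∈ closure G, v z + (g z : EReal) ≤ v z₀ + (g z₀ : EReal) := hmax
    have hbig : ((ε * R ^ 2 : ℝ) : EReal) < v z₀ + (g z₀ : EReal) := by
      refine lt_of_lt_of_le ?_ (hmax z₁ (subset_closure hz₁))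
      rw [hV₁, ← EReal.coe_add, EReal.coe_lt_coe_iff, hg]
      have : 0 ≤ ε * ‖z₁‖ ^ 2 := by positivity
      simp only
      linarith
    have hz₀G : z₀ ∈ G := by
      by_contra hn
      have hf : z₀ ∈ frontier G := by rw [hG.frontier_eq]; exact ⟨hz₀, hn⟩
      have h1 := hfr z₀ hf
      rw [hu _ hz₀] at h1
      have h2 : v z₀ + (g z₀ : EReal) ≤ ((U z₀ + g z₀ : ℝ) : EReal) := by
        rw [EReal.coe_add]
        gcongr
      have h3 := hbig.trans_le h2
      rw [EReal.coe_lt_coe_iff] at h3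
      have h4 : ‖z₀‖ ^ 2 ≤ R ^ 2 := by gcongr; exact hR _ hz₀
      simp only [hg] at h3
      nlinarith
    obtain ⟨V₀, hV₀⟩ : ∃ V : ℝ, v z₀ = V := by
      refine ⟨(v z₀).toReal, (EReal.coe_toReal (hv.lt_top _ hz₀G).ne ?_).symm⟩
      intro hb
      rw [hb, EReal.bot_add] at hbig
      exact not_lt_bot hbig
    have hvle : ∀ z ∈ closure G, v z ≤ ((V₀ + g z₀ - g z : ℝ) : EReal) := by
      intro z hz
      have := hmax z hz
      rw [hV₀, ← EReal.coe_add] at this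
      rw [EReal.coe_sub]
      exact (EReal.le_sub_iff_add_le (Or.inl (EReal.coe_ne_bot _))
        (Or.inl (EReal.coe_ne_top _))).2 this
    obtain ⟨b, hb, C, r₀, hr₀, hF⟩ := exists_line_halfLogNormSq_le (hD z₀ (hGD hz₀))
    obtain ⟨ρ, hρ, hball⟩ := Metric.isOpen_iff.1 hG z₀ hz₀G
    have hbpos : 0 < ‖b‖ := norm_pos_iff.2 hb
    -- On the disc of radius `r‖b‖` about the maximum point, `v` is bounded by a constant plus `u -
    -- ε‖z‖²`. The mean of `u` rises by at most `C r⁴` and that of `ε‖z‖²` rises by exactly `ε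
    -- r²‖b‖²`. The sub-mean value inequality for `v` yields the claim, which fails as `r → 0`.
    have main : ∀ r : ℝ, 0 < r → r ≤ r₀ → r < ρ / ‖b‖ → ε * ‖b‖ ^ 2 ≤ C * r ^ 2 := by
      intro r hr hr1 hr2
      obtain ⟨F, hFi, hFavg, hFle⟩ := hF r hr hr1
      have hdisc : ∀ ζ : ℂ, ‖ζ‖ ≤ 1 → z₀ + ζ • ((r : ℂ) • b) ∈ G := by
        intro ζ hζ
        apply hball
        rw [Metric.mem_ball, dist_self_add_left, norm_smul, norm_smul, Complex.norm_real,
          Real.norm_of_nonneg hr.le]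
        rw [lt_div_iff₀ hbpos] at hr2
        nlinarith [mul_pos hr hbpos]
      have hsub := hv.le_mean z₀ ((r : ℂ) • b) hdisc
      set S : ℂ → ℝ := fun ζ => F ζ + ((V₀ + g z₀) + (-ε) * ‖z₀ + ζ • ((r : ℂ) • b)‖ ^ 2) with hS
      have hSq : CircleIntegrable (fun ζ => ‖z₀ + ζ • ((r : ℂ) • b)‖ ^ 2) 0 1 :=
        ContinuousOn.circleIntegrable' (by fun_prop)
      have hSq' : CircleIntegrable (fun ζ => (-ε) * ‖z₀ + ζ • ((r : ℂ) • b)‖ ^ 2) 0 1 :=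
        ContinuousOn.circleIntegrable' (by fun_prop)
      have hc : CircleIntegrable (fun _ : ℂ => V₀ + g z₀) 0 1 := circleIntegrable_const _ _ _
      have hSi : CircleIntegrable S 0 1 := hFi.add (hc.add hSq')
      have hSavg : Real.circleAverage S 0 1 = 1 / 2 * Real.log (N z₀) + C * r ^ 4 +
          ((V₀ + g z₀) + (-ε) * (‖z₀‖ ^ 2 + ‖(r : ℂ) • b‖ ^ 2)) := by
        have e1 := Real.circleAverage_add hFi (hc.add hSq')
        have e2 := Real.circleAverage_add hc hSq'
        have e3 := Real.circleAverage_fun_smul (a := -ε)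
          (f := fun ζ : ℂ => ‖z₀ + ζ • ((r : ℂ) • b)‖ ^ 2) (c := 0) (R := 1)
        simp only [smul_eq_mul] at e3
        rw [e2, Real.circleAverage_const, e3, circleAverage_norm_sq, hFavg] at e1
        exact e1
      have hle : v z₀ ≤ ((Real.circleAverage S 0 1 : ℝ) : EReal) := by
        rw [← angularMean_coe_circle hSi]
        refine hsub.trans (angularMean_mono_ae (Eventually.of_forall fun θ => ?_))
        have hn : ‖Complex.exp (θ * Complex.I)‖ = 1 := Complex.norm_exp_ofReal_mul_I θ
        refine (hvle _ (subset_closure (hdisc _ hn.le))).trans ?_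
        rw [EReal.coe_le_coe_iff]
        have := hFle _ hn
        simp only [hS, hg, hU, hN] at this ⊢
        linarith
      rw [hV₀, EReal.coe_le_coe_iff, hSavg, norm_smul, Complex.norm_real,
        Real.norm_of_nonneg hr.le] at hle
      simp only [hg, hU] at hle
      have : ε * ‖b‖ ^ 2 * r ^ 2 ≤ C * r ^ 2 * r ^ 2 := by nlinarith
      exact le_of_mul_le_mul_right this (by positivity)
    have hlim : Tendsto (fun r : ℝ => C * r ^ 2) (𝓝[>] 0) (𝓝 0) := by
      have : Continuous fun r : ℝ => C * r ^ 2 := by fun_prop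
      simpa using (this.tendsto 0).mono_left nhdsWithin_le_nhds
    have hev : ∀ᶠ r in 𝓝[>] (0 : ℝ), ε * ‖b‖ ^ 2 ≤ C * r ^ 2 := by
      have hm : 0 < min r₀ (ρ / ‖b‖) := lt_min hr₀ (by positivity)
      filter_upwards [Ioo_mem_nhdsGT hm] with r hr
      exact main r hr.1 (hr.2.le.trans (min_le_left _ _)) (hr.2.trans_le (min_le_right _ _))
    have := ge_of_tendsto hlim hev
    have : 0 < ε * ‖b‖ ^ 2 := by positivity
    linarith

/-! ### Barycentric coordinates and the triangle with ordinary sides. -/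

/-- Twice the signed area of the triangle `a b c` in `ℂ²`; it vanishes exactly when the three points
are collinear. -/
def cross (a b c : EuclideanSpace ℂ (Fin 2)) : ℂ :=
  (b 0 - a 0) * (c 1 - a 1) - (b 1 - a 1) * (c 0 - a 0)

/-- The linear polynomial defining the line through `a` and `b`. -/
noncomputable def linePoly (a b : EuclideanSpace ℂ (Fin 2)) : MvPolynomial (Fin 2) ℂ :=
  MvPolynomial.C (b 0 - a 0) * (MvPolynomial.X 1 - MvPolynomial.C (a 1)) -
    MvPolynomial.C (b 1 - a 1) * (MvPolynomial.X 0 - MvPolynomial.C (a 0))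

@[simp]
theorem eval_linePoly (a b z : EuclideanSpace ℂ (Fin 2)) :
    MvPolynomial.eval (fun i => z i) (linePoly a b) = cross a b z := by
  simp [linePoly, cross]

theorem totalDegree_linePoly_le (a b : EuclideanSpace ℂ (Fin 2)) :
    (linePoly a b).totalDegree ≤ 1 := by
  have h : ∀ (i : Fin 2) (c d : ℂ),
      (MvPolynomial.C c * (MvPolynomial.X i - MvPolynomial.C d) :
        MvPolynomial (Fin 2) ℂ).totalDegree ≤ 1 := by
    intro i c d
    refine (MvPolynomial.totalDegree_mul _ _).trans ?_
    rw [MvPolynomial.totalDegree_C, zero_add]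
    refine (MvPolynomial.totalDegree_sub_C_le _ _).trans ?_
    simp
  exact (MvPolynomial.totalDegree_sub _ _).trans (max_le (h _ _ _) (h _ _ _))

theorem linePoly_ne_zero {a b : EuclideanSpace ℂ (Fin 2)} (h : a ≠ b) : linePoly a b ≠ 0 := by
  intro h0
  apply h
  have e1 := eval_linePoly a b (a + EuclideanSpace.single 1 1)
  have e2 := eval_linePoly a b (a + EuclideanSpace.single 0 1)
  rw [h0, map_zero] at e1 e2
  simp [cross] at e1 e2
  ext i
  fin_cases i
  · exact (sub_eq_zero.1 e1.symm).symm
  · exact sub_eq_zero.1 e2.symm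

theorem cross_swap (a b c : EuclideanSpace ℂ (Fin 2)) : cross b a c = -cross a b c := by
  unfold cross; ring

theorem cross_rotate (a b c : EuclideanSpace ℂ (Fin 2)) : cross b c a = cross a b c := by
  unfold cross; ring

theorem cross_self_left (a c : EuclideanSpace ℂ (Fin 2)) : cross a c a = 0 := by
  unfold cross; ring

theorem cross_self_right (a c : EuclideanSpace ℂ (Fin 2)) : cross a c c = 0 := by
  unfold cross; ring

/-- The barycentric coordinates of a point with respect to a triangle add up to a constant. -/
theorem cross_add_cross_add_cross (t₁ t₂ t₃ z : EuclideanSpace ℂ (Fin 2)) :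
    cross t₂ t₃ z + cross t₃ t₁ z + cross t₁ t₂ z = cross t₁ t₂ t₃ := by
  unfold cross; ring

/-- The three cross products are the barycentric coordinates of `z`, scaled to have sum `cross t₁ t₂
t₃`. They serve as homogeneous coordinates in all that follows. -/
theorem cross_smul_eq (t₁ t₂ t₃ z : EuclideanSpace ℂ (Fin 2)) :
    cross t₁ t₂ t₃ • z = cross t₂ t₃ z • t₁ + cross t₃ t₁ z • t₂ + cross t₁ t₂ z • t₃ := by
  ext i
  fin_cases i <;> simp [cross] <;> ring

theorem eq_of_cross_eq {t₁ t₂ t₃ z z' : EuclideanSpace ℂ (Fin 2)} (hD : cross t₁ t₂ t₃ ≠ 0)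
    (h1 : cross t₂ t₃ z = cross t₂ t₃ z') (h2 : cross t₃ t₁ z = cross t₃ t₁ z')
    (h3 : cross t₁ t₂ z = cross t₁ t₂ z') : z = z' := by
  have e := cross_smul_eq t₁ t₂ t₃ z
  rw [h1, h2, h3, ← cross_smul_eq] at e
  exact smul_right_injective _ hD e

/-- The Fano plane cannot be realized over `ℂ`. -/
theorem fano_not_realizable {p a a' b b' c c' : EuclideanSpace ℂ (Fin 2)}
    (hD : cross a' b' c' ≠ 0) (hx : cross b' c' p ≠ 0) (hy : cross c' a' p ≠ 0)
    (hw : cross a' b' p ≠ 0) (hpa : cross p a a' = 0) (hpb : cross p b b' = 0)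
    (hpc : cross p c c' = 0) (habc : cross a b c = 0) (hab'c' : cross a b' c' = 0)
    (ha'bc' : cross a' b c' = 0) (ha'b'c : cross a' b' c = 0) : False := by
  have hxa : cross b' c' a = 0 := by rw [cross_rotate]; exact hab'c'
  have hyb : cross c' a' b = 0 := by rw [← cross_rotate]; exact ha'bc'
  have ea := cross_add_cross_add_cross a' b' c' a
  have eb := cross_add_cross_add_cross a' b' c' b
  have ec := cross_add_cross_add_cross a' b' c' c
  -- In coordinates for the triangle `a' b' c'` let `p = (x, y, w)`. Since `a` is on `b' c'` and on
  -- `p a'`, it is proportional to `(0, y, w)`; likewise `b` to `(x, 0, w)` and `c` to `(x, y, 0)`.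
  -- The determinant of these rows is `2xyw`, which is nonzero, although `a, b, c` are collinear.
  have ra : cross c' a' a * cross a' b' p = cross a' b' a * cross c' a' p := by
    have : cross c' a' a * cross a' b' p - cross a' b' a * cross c' a' p =
      -(cross a' b' c' * cross p a a') := by unfold cross; ring
    rw [hpa, mul_zero, neg_zero] at this
    exact sub_eq_zero.1 this
  have rb : cross a' b' b * cross b' c' p = cross b' c' b * cross a' b' p := by
    have : cross a' b' b * cross b' c' p - cross b' c' b * cross a' b' p =
      -(cross a' b' c' * cross p b b') := by unfold cross; ring
    rw [hpb, mul_zero, neg_zero] at this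
    exact sub_eq_zero.1 this
  have rc : cross b' c' c * cross c' a' p = cross c' a' c * cross b' c' p := by
    have : cross b' c' c * cross c' a' p - cross c' a' c * cross b' c' p =
      -(cross a' b' c' * cross p c c') := by unfold cross; ring
    rw [hpc, mul_zero, neg_zero] at this
    exact sub_eq_zero.1 this
  have hdet : cross c' a' a * cross a' b' b * cross b' c' c +
      cross a' b' a * cross b' c' b * cross c' a' c = 0 := by
    have : cross b' c' a * (cross c' a' b * cross a' b' c - cross a' b' b * cross c' a' c)
        - cross c' a' a * (cross b' c' b * cross a' b' c - cross a' b' b * cross b' c' c)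
        + cross a' b' a * (cross b' c' b * cross c' a' c - cross c' a' b * cross b' c' c) =
        cross a' b' c' ^ 2 * cross a b c := by unfold cross; ring
    rw [hxa, hyb, ha'b'c, habc] at this
    linear_combination this
  rw [hxa] at ea
  rw [hyb] at eb
  rw [ha'b'c] at ec
  have key : 2 * (cross a' b' a * cross b' c' b * cross c' a' c) *
      (cross b' c' p * cross c' a' p * cross a' b' p) = 0 := by
    linear_combination (cross b' c' p * cross c' a' p * cross a' b' p) * hdet -
      (cross a' b' b * cross b' c' p) * (cross b' c' c * cross c' a' p) * ra -
      (cross a' b' a * cross c' a' p) * (cross b' c' c * cross c' a' p) * rb -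
      (cross a' b' a * cross c' a' p) * (cross b' c' b * cross a' b' p) * rc
  have hp : cross b' c' p * cross c' a' p * cross a' b' p ≠ 0 := mul_ne_zero (mul_ne_zero hx hy) hw
  rcases mul_eq_zero.1 key with h | h
  swap
  · exact hp h
  -- If one of these coordinates of `a`, `b` or `c` vanished, all three coordinates of that point
  -- would vanish, against their sum being nonzero.
  rcases mul_eq_zero.1 ((mul_eq_zero.1 h).resolve_left two_ne_zero) with h | h
  · rcases mul_eq_zero.1 h with h | h
    · rw [h, zero_mul] at ra
      have := (mul_eq_zero.1 ra).resolve_right hw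
      rw [h, this] at ea
      exact hD (by linear_combination -ea)
    · rw [h, zero_mul] at rb
      have := (mul_eq_zero.1 rb).resolve_right hx
      rw [h, this] at eb
      exact hD (by linear_combination -eb)
  · rw [h, zero_mul] at rc
    have := (mul_eq_zero.1 rc).resolve_right hy
    rw [h, this] at ec
    exact hD (by linear_combination -ec)

section
variable {S : Finset (EuclideanSpace ℂ (Fin 2))}

/-- If conics contain at most five points of `S`, a polynomial of degree at most two vanishing
at six points of `S` is zero. -/
theorem eq_zero_of_totalDegree_le_two (hm : maxPointsOnCurve 2 S = 5)
    {P : MvPolynomial (Fin 2) ℂ} (hP : P.totalDegree ≤ 2)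
    (T : Finset (EuclideanSpace ℂ (Fin 2))) (hT : T ⊆ S) (hcard : 5 < T.card)
    (h0 : ∀ z ∈ T, MvPolynomial.eval (fun i => z i) P = 0) : P = 0 := by
  by_contra hne
  -- `maxPointsOnCurve` only admits polynomials of degree exactly 2, so the degree is filled up by a
  -- power of a coordinate, which can only enlarge the zero set.
  set R := P * MvPolynomial.X 0 ^ (2 - P.totalDegree) with hR
  have hX : (MvPolynomial.X 0 : MvPolynomial (Fin 2) ℂ) ^ (2 - P.totalDegree) ≠ 0 :=
    pow_ne_zero _ (MvPolynomial.X_ne_zero 0)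
  have hRne : R ≠ 0 := mul_ne_zero hne hX
  have hRd : R.totalDegree = 2 := by
    rw [hR, MvPolynomial.totalDegree_mul_of_isDomain hne hX, MvPolynomial.totalDegree_X_pow]
    omega
  have hbdd : BddAbove {k | ∃ P : MvPolynomial (Fin 2) ℂ, P ≠ 0 ∧ P.totalDegree = 2 ∧
      k = ((S : Set (EuclideanSpace ℂ (Fin 2))) ∩ planeCurve P).ncard} := by
    refine ⟨S.card, ?_⟩
    rintro k ⟨P, -, -, rfl⟩
    rw [← Set.ncard_coe_finset]
    exact Set.ncard_le_ncard Set.inter_subset_left S.finite_toSet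
  have hle := le_csSup hbdd ⟨R, hRne, hRd, rfl⟩
  change _ ≤ maxPointsOnCurve 2 S at hle
  have hsub : (T : Set (EuclideanSpace ℂ (Fin 2))) ⊆ ↑S ∩ planeCurve R := by
    intro z hz
    refine ⟨hT hz, ?_⟩
    simp only [planeCurve, Set.mem_ofPred_eq, hR, map_mul, h0 z hz, zero_mul]
  have := Set.ncard_le_ncard hsub (S.finite_toSet.inter_of_left _)
  rw [Set.ncard_coe_finset] at this
  omega

end

section
variable {S : Finset (EuclideanSpace ℂ (Fin 2))}

/-- A pair of lines is a degenerate conic and so contains at most five points of `S`. -/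
theorem exists_mem_cross_ne_zero (hm : maxPointsOnCurve 2 S = 5)
    {a b c d : EuclideanSpace ℂ (Fin 2)} (hab : a ≠ b) (hcd : c ≠ d)
    (T : Finset (EuclideanSpace ℂ (Fin 2))) (hT : T ⊆ S) (hcard : 5 < T.card) :
    ∃ z ∈ T, cross a b z ≠ 0 ∧ cross c d z ≠ 0 := by
  by_contra! h
  have hd : (linePoly a b * linePoly c d).totalDegree ≤ 2 :=
    (MvPolynomial.totalDegree_mul _ _).trans
      (add_le_add (totalDegree_linePoly_le a b) (totalDegree_linePoly_le c d))
  refine mul_ne_zero (linePoly_ne_zero hab) (linePoly_ne_zero hcd)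
    (eq_zero_of_totalDegree_le_two hm hd T hT hcard fun z hz => ?_)
  rw [map_mul, eval_linePoly, eval_linePoly]
  by_cases hz0 : cross a b z = 0
  · rw [hz0, zero_mul]
  · rw [h z hz hz0, mul_zero]

/-- If `S` has seven points and conics contain at most five of them, there is a triangle of points
of `S` whose sides contain no other point of `S`. -/
theorem exists_triangle (hcard : S.card = 7) (hm : maxPointsOnCurve 2 S = 5) :
    ∃ t₁ ∈ S, ∃ t₂ ∈ S, ∃ t₃ ∈ S, t₁ ≠ t₂ ∧ t₁ ≠ t₃ ∧ t₂ ≠ t₃ ∧ cross t₁ t₂ t₃ ≠ 0 ∧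
      ∀ p ∈ S, p ≠ t₁ → p ≠ t₂ → p ≠ t₃ →
        cross t₂ t₃ p ≠ 0 ∧ cross t₃ t₁ p ≠ 0 ∧ cross t₁ t₂ p ≠ 0 := by
  classical
  let col : EuclideanSpace ℂ (Fin 2) → EuclideanSpace ℂ (Fin 2) → EuclideanSpace ℂ (Fin 2) →
      Prop := fun a b c => (a ∈ S ∧ b ∈ S ∧ c ∈ S) ∧ (a ≠ b ∧ a ≠ c ∧ b ≠ c) ∧ cross a b c = 0
  have h1 : ∀ a b c, col a b c → col b a c := by
    rintro a b c ⟨⟨ha, hb, hc⟩, ⟨hab, hac, hbc⟩, h⟩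
    exact ⟨⟨hb, ha, hc⟩, ⟨hab.symm, hbc, hac⟩, by rw [cross_swap, h, neg_zero]⟩
  have h2 : ∀ a b c, col a b c → col a c b := by
    rintro a b c ⟨⟨ha, hb, hc⟩, ⟨hab, hac, hbc⟩, h⟩
    exact ⟨⟨ha, hc, hb⟩, ⟨hac, hab, hbc.symm⟩, by
      rw [cross_swap, cross_rotate b c a, cross_rotate a b c, h, neg_zero]⟩
  have h4 : ∀ a b c d, col a b c → col a b d → c = d := by
    rintro a b c d ⟨⟨ha, hb, hc⟩, ⟨hab, hac, hbc⟩, h⟩ ⟨⟨-, -, hd⟩, ⟨-, had, hbd⟩, h'⟩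
    by_contra hcd
    -- Four collinear points and two others lie on a pair of lines.
    have hT : 1 < (S \ {a, b, c, d}).card := by
      have := Finset.le_card_sdiff {a, b, c, d} S
      have := Finset.card_le_four (a := a) (b := b) (c := c) (d := d)
      omega
    obtain ⟨e, he, f, hf, hef⟩ := Finset.one_lt_card.1 hT
    simp only [Finset.mem_sdiff, Finset.mem_insert, Finset.mem_singleton, not_or] at he hf
    have hn : [a, b, c, d, e, f].Nodup := by
      simp only [List.nodup_cons, List.mem_cons, List.not_mem_nil]
      clear h1 h2 col
      grind
    obtain ⟨z, hz, hz1, hz2⟩ := exists_mem_cross_ne_zero hm hab hef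
      [a, b, c, d, e, f].toFinset (by
        intro w hw
        simp only [List.mem_toFinset, List.mem_cons, List.not_mem_nil, or_false] at hw
        rcases hw with rfl | rfl | rfl | rfl | rfl | rfl
        exacts [ha, hb, hc, hd, he.1, hf.1])
      (by rw [List.toFinset_card_of_nodup hn]; simp)
    simp only [List.mem_toFinset, List.mem_cons, List.not_mem_nil, or_false] at hz
    rcases hz with rfl | rfl | rfl | rfl | rfl | rfl
    exacts [hz1 (cross_self_left _ _), hz1 (cross_self_right _ _), hz1 h, hz1 h',
      hz2 (cross_self_left _ _), hz2 (cross_self_right _ _)]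
  have h33 : ∀ a b c d e f, col a b c → col d e f →
      a = d ∨ a = e ∨ a = f ∨ b = d ∨ b = e ∨ b = f ∨ c = d ∨ c = e ∨ c = f := by
    rintro a b c d e f ⟨⟨ha, hb, hc⟩, ⟨hab, hac, hbc⟩, h⟩ ⟨⟨hd, he, hf⟩, ⟨hde, hdf, hef⟩, h'⟩
    by_contra! hne
    have hn : [a, b, c, d, e, f].Nodup := by
      simp only [List.nodup_cons, List.mem_cons, List.not_mem_nil]
      clear h1 h2 h4 col
      grind
    obtain ⟨z, hz, hz1, hz2⟩ := exists_mem_cross_ne_zero hm hab hde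
      [a, b, c, d, e, f].toFinset (by
        intro w hw
        simp only [List.mem_toFinset, List.mem_cons, List.not_mem_nil, or_false] at hw
        rcases hw with rfl | rfl | rfl | rfl | rfl | rfl
        exacts [ha, hb, hc, hd, he, hf])
      (by rw [List.toFinset_card_of_nodup hn]; simp)
    simp only [List.mem_toFinset, List.mem_cons, List.not_mem_nil, or_false] at hz
    rcases hz with rfl | rfl | rfl | rfl | rfl | rfl
    exacts [hz1 (cross_self_left _ _), hz1 (cross_self_right _ _), hz1 h,
      hz2 (cross_self_left _ _), hz2 (cross_self_right _ _), hz2 h']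
  have hF : ∀ p a a' b b' c c', col p a a' → col p b b' → col p c c' →
      col a b c → col a b' c' → col a' b c' → col a' b' c → False := by
    intro p a a' b b' c c' hA hB hC k1 k2 k3 k4
    refine fano_not_realizable (p := p) (a := a) (a' := a') (b := b) (b' := b') (c := c) (c' := c')
      (fun h => ?_) (fun h => ?_) (fun h => ?_) (fun h => ?_) hA.2.2 hB.2.2 hC.2.2 k1.2.2 k2.2.2
      k3.2.2 k4.2.2
    -- Each degenerate position of the triangle `a' b' c'` and `p` gives a second third point on one
    -- of the given lines, against `h4`.
    · have : col a' b' c' := ⟨⟨k4.1.1, k4.1.2.1, k3.1.2.2⟩, ⟨k4.2.1.1, k3.2.1.2.1, k2.2.1.2.2⟩, h⟩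
      exact hC.2.1.2.2 (h4 _ _ _ _ k4 this)
    · have : col p b' c' := ⟨⟨hB.1.1, hB.1.2.2, hC.1.2.2⟩, ⟨hB.2.1.2.1, hC.2.1.2.1, k2.2.1.2.2⟩,
        by rw [← cross_rotate]; exact h⟩
      exact k3.2.1.2.2 (h4 _ _ _ _ (h2 _ _ _ hB) this)
    · have : col p c' a' := ⟨⟨hC.1.1, hC.1.2.2, hA.1.2.2⟩, ⟨hC.2.1.2.1, hA.2.1.2.1,
        k3.2.1.2.1.symm⟩, by rw [← cross_rotate]; exact h⟩
      exact k4.2.1.2.1 (h4 _ _ _ _ (h2 _ _ _ hC) this).symm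
    · have : col p a' b' := ⟨⟨hA.1.1, hA.1.2.2, hB.1.2.2⟩, ⟨hA.2.1.2.1, hB.2.1.2.1, k4.2.1.1⟩,
        by rw [← cross_rotate]; exact h⟩
      exact k2.2.1.1 (h4 _ _ _ _ (h2 _ _ _ hA) this)
  obtain ⟨x, hx, y, hy, z, hz, hxy, hxz, hyz, k1, k2, k3⟩ := exists_ordinary_triangle S hcard col
    (fun a b c h => ⟨h.1.1, h.2.1.1⟩) h1 h2 h4 h33 hF
  refine ⟨x, hx, y, hy, z, hz, hxy, hxz, hyz,
    fun h => k1 z ⟨⟨hx, hy, hz⟩, ⟨hxy, hxz, hyz⟩, h⟩, fun p hp hpx hpy hpz => ⟨?_, ?_, ?_⟩⟩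
  · exact fun h => k3 p ⟨⟨hy, hz, hp⟩, ⟨hyz, hpy.symm, hpz.symm⟩, h⟩
  · exact fun h => k2 p ⟨⟨hx, hz, hp⟩, ⟨hxz, hpx.symm, hpz.symm⟩, by rw [cross_swap, h, neg_zero]⟩
  · exact fun h => k1 p ⟨⟨hx, hy, hp⟩, ⟨hxy, hpx.symm, hpy.symm⟩, h⟩

end

/-! ### The quadratic Cremona transformation. -/

/-- The value of the conic through the vertices of the coordinate triangle and the points with
barycentric coordinates `(a, b, c)` and `(a', b', c')`. -/
def conicForm (a b c a' b' c' x y w : ℂ) : ℂ :=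
  (a * c * (a' * b') - a * b * (a' * c')) * (y * w) +
    (a * b * (b' * c') - b * c * (a' * b')) * (x * w) +
    (b * c * (a' * c') - a * c * (b' * c')) * (x * y)

/-- `conicForm` is the determinant of the Cremona images `(bc, ac, ab)` of its three points. With
images `u, v, v'', s` this is the first component of Cramer's rule modulo `u`, `det(u, v, v'') (u ×
s) = det(u, s, v'') (u × v) + det(u, v, s) (u × v'')`. -/
theorem conicForm_mul_eq (a b c a' b' c' a'' b'' c'' x y w : ℂ) :
    conicForm a b c a' b' c' a'' b'' c'' * (a * (x * (c * y - b * w))) =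
      (a'' * c'' * (a * b) - a'' * b'' * (a * c)) * -conicForm a b c a' b' c' x y w +
        (a' * c' * (a * b) - a' * b' * (a * c)) * conicForm a b c a'' b'' c'' x y w := by
  unfold conicForm; ring

theorem conicForm_rotate (a b c a' b' c' x y w : ℂ) :
    conicForm b c a b' c' a' y w x = conicForm a b c a' b' c' x y w := by
  unfold conicForm; ring

/-- The size of the vector product of the Cremona images of `(a, b, c)` and `(x, y, w)`. -/
noncomputable def cremonaDist (a b c x y w : ℂ) : ℝ :=
  ‖x * (c * y - b * w)‖ + ‖y * (a * w - c * x)‖ + ‖w * (b * x - a * y)‖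

theorem cremonaDist_rotate (a b c x y w : ℂ) :
    cremonaDist b c a y w x = cremonaDist a b c x y w := by
  unfold cremonaDist; ring

theorem norm_conicForm_swap (a b c a' b' c' x y w : ℂ) :
    ‖conicForm a b c a' b' c' x y w‖ = ‖conicForm a' b' c' a b c x y w‖ := by
  rw [← norm_neg]
  congr 1
  unfold conicForm; ring

theorem exists_norm_le_of_conicForm_ne_zero {a b c a' b' c' a'' b'' c'' : ℂ} (ha : a ≠ 0)
    (h : conicForm a b c a' b' c' a'' b'' c'' ≠ 0) :
    ∃ K > 0, ∀ x y w : ℂ, ‖x * (c * y - b * w)‖ ≤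
      K * (‖conicForm a b c a' b' c' x y w‖ + ‖conicForm a b c a'' b'' c'' x y w‖) := by
  set Δ := conicForm a b c a' b' c' a'' b'' c'' with hΔ
  set α := a'' * c'' * (a * b) - a'' * b'' * (a * c)
  set β := a' * c' * (a * b) - a' * b' * (a * c)
  have hΔa : 0 < ‖Δ * a‖ := norm_pos_iff.2 (mul_ne_zero h ha)
  refine ⟨(‖α‖ + ‖β‖ + 1) / ‖Δ * a‖, by positivity, fun x y w => ?_⟩
  have e := conicForm_mul_eq a b c a' b' c' a'' b'' c'' x y w
  rw [← hΔ, ← mul_assoc] at e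
  have e' := congrArg norm e
  rw [norm_mul] at e'
  have hle := (norm_add_le (α * -conicForm a b c a' b' c' x y w)
    (β * conicForm a b c a'' b'' c'' x y w))
  rw [norm_mul, norm_mul, norm_neg] at hle
  rw [div_mul_eq_mul_div, le_div_iff₀ hΔa, mul_comm, e']
  refine hle.trans ?_
  nlinarith [norm_nonneg α, norm_nonneg β, norm_nonneg (conicForm a b c a' b' c' x y w),
    norm_nonneg (conicForm a b c a'' b'' c'' x y w),
    mul_nonneg (norm_nonneg α) (norm_nonneg (conicForm a b c a'' b'' c'' x y w)),
    mul_nonneg (norm_nonneg β) (norm_nonneg (conicForm a b c a' b' c' x y w))]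

/-- If the three Cremona images are linearly independent, the two lines joining the first image to
the others are distinct, and their equations together bound the distance to their intersection.
Cyclic symmetry reduces all components of the vector product to the first one. -/
theorem exists_cremonaDist_le {a b c a' b' c' a'' b'' c'' : ℂ} (ha : a ≠ 0) (hb : b ≠ 0)
    (hc : c ≠ 0) (h : conicForm a b c a' b' c' a'' b'' c'' ≠ 0) :
    ∃ K > 0, ∀ x y w : ℂ, cremonaDist a b c x y w ≤
      K * (‖conicForm a b c a' b' c' x y w‖ + ‖conicForm a b c a'' b'' c'' x y w‖) := by
  obtain ⟨K₁, hK₁, h₁⟩ := exists_norm_le_of_conicForm_ne_zero ha h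
  obtain ⟨K₂, hK₂, h₂⟩ := exists_norm_le_of_conicForm_ne_zero (a := b) (b := c) (c := a)
    (a' := b') (b' := c') (c' := a') (a'' := b'') (b'' := c'') (c'' := a'') hb
    (by rwa [conicForm_rotate])
  obtain ⟨K₃, hK₃, h₃⟩ := exists_norm_le_of_conicForm_ne_zero (a := c) (b := a) (c := b)
    (a' := c') (b' := a') (c' := b') (a'' := c'') (b'' := a'') (c'' := b'') hc
    (by rwa [conicForm_rotate, conicForm_rotate])
  refine ⟨K₁ + K₂ + K₃, by positivity, fun x y w => ?_⟩
  have e1 := h₁ x y w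
  have e2 := h₂ y w x
  have e3 := h₃ w x y
  rw [conicForm_rotate a b c a' b' c', conicForm_rotate a b c a'' b'' c''] at e2
  rw [conicForm_rotate b c a b' c' a', conicForm_rotate b c a b'' c'' a'',
    conicForm_rotate a b c a' b' c', conicForm_rotate a b c a'' b'' c''] at e3
  unfold cremonaDist
  linarith

/-- Off the sides the Cremona map is injective on the projective plane, and the equal sums fix the
scale. A zero on a side has to be a vertex, where the map is undefined. -/
theorem eq_of_cremonaDist_eq_zero {a b c x y w : ℂ} (ha : a ≠ 0) (hb : b ≠ 0) (hc : c ≠ 0)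
    (hD : a + b + c ≠ 0) (hs : x + y + w = a + b + c) (h : cremonaDist a b c x y w = 0) :
    (x = a ∧ y = b ∧ w = c) ∨ (y = 0 ∧ w = 0) ∨ (w = 0 ∧ x = 0) ∨ (x = 0 ∧ y = 0) := by
  unfold cremonaDist at h
  have n1 := norm_nonneg (x * (c * y - b * w))
  have n2 := norm_nonneg (y * (a * w - c * x))
  have n3 := norm_nonneg (w * (b * x - a * y))
  have h1 : x * (c * y - b * w) = 0 := by rw [← norm_le_zero_iff]; linarith
  have h2 : y * (a * w - c * x) = 0 := by rw [← norm_le_zero_iff]; linarith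
  have h3 : w * (b * x - a * y) = 0 := by rw [← norm_le_zero_iff]; linarith
  by_cases hx : x = 0
  · subst hx
    have : y * w = 0 := by
      apply mul_left_cancel₀ ha
      linear_combination h2
    rcases mul_eq_zero.1 this with h | h
    · exact Or.inr (Or.inr (Or.inr ⟨rfl, h⟩))
    · exact Or.inr (Or.inr (Or.inl ⟨h, rfl⟩))
  by_cases hy : y = 0
  · subst hy
    have : w * x = 0 := by
      apply mul_left_cancel₀ hb
      linear_combination h3
    exact Or.inr (Or.inl ⟨rfl, (mul_eq_zero.1 this).resolve_right hx⟩)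
  by_cases hw : w = 0
  · subst hw
    have : x * y = 0 := by
      apply mul_left_cancel₀ hc
      linear_combination h1
    exact absurd this (mul_ne_zero hx hy)
  left
  have e1 := (mul_eq_zero.1 h1).resolve_left hx
  have e2 := (mul_eq_zero.1 h2).resolve_left hy
  have e3 := (mul_eq_zero.1 h3).resolve_left hw
  refine ⟨mul_left_cancel₀ hD ?_, mul_left_cancel₀ hD ?_, mul_left_cancel₀ hD ?_⟩
  · linear_combination e3 - e2 + a * hs
  · linear_combination e1 - e3 + b * hs
  · linear_combination e2 - e1 + c * hs

/-! ### Lower bounds for the distance at the vertices, at the point itself and at infinity. -/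

/-- The distance function `cremonaDist` of two points with respect to a triangle. -/
noncomputable def triangleDist (t₁ t₂ t₃ p z : EuclideanSpace ℂ (Fin 2)) : ℝ :=
  cremonaDist (cross t₂ t₃ p) (cross t₃ t₁ p) (cross t₁ t₂ p)
    (cross t₂ t₃ z) (cross t₃ t₁ z) (cross t₁ t₂ z)

theorem triangleDist_rotate (t₁ t₂ t₃ p z : EuclideanSpace ℂ (Fin 2)) :
    triangleDist t₂ t₃ t₁ p z = triangleDist t₁ t₂ t₃ p z :=
  cremonaDist_rotate _ _ _ _ _ _

theorem continuous_cross (a b : EuclideanSpace ℂ (Fin 2)) : Continuous (cross a b) := by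
  unfold cross; fun_prop

/-- At `t₁` the first coordinate tends to `cross t₁ t₂ t₃` and the other two, `y` and `w`, are
small. Two terms of the distance are then comparable to `|y|` and `|w|`, and `z - t₁` is linear in
`y, w`. -/
theorem eventually_le_triangleDist_vertex {t₁ t₂ t₃ p : EuclideanSpace ℂ (Fin 2)}
    (hD : cross t₁ t₂ t₃ ≠ 0) (hb : cross t₃ t₁ p ≠ 0) (hc : cross t₁ t₂ p ≠ 0) :
    ∃ κ > 0, ∀ᶠ z in 𝓝 t₁, κ * ‖z - t₁‖ ≤ triangleDist t₁ t₂ t₃ p z := by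
  set D := cross t₁ t₂ t₃ with hDdef
  set a := cross t₂ t₃ p
  set b := cross t₃ t₁ p
  set c := cross t₁ t₂ p
  have hx1 : cross t₂ t₃ t₁ = D := cross_rotate _ _ _
  have hy1 : cross t₃ t₁ t₁ = 0 := cross_self_right _ _
  have hw1 : cross t₁ t₂ t₁ = 0 := cross_self_left _ _
  have cx := continuous_cross t₂ t₃
  have cy := continuous_cross t₃ t₁
  have cw := continuous_cross t₁ t₂
  set L := ‖t₂ - t₁‖ + ‖t₃ - t₁‖ + 1 with hL
  have hLpos : 0 < L := by positivity
  set δ := min (‖c * D‖ / 2) (‖b * D‖ / 2) with hδ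
  have hcD : 0 < ‖c * D‖ := norm_pos_iff.2 (mul_ne_zero hc hD)
  have hbD : 0 < ‖b * D‖ := norm_pos_iff.2 (mul_ne_zero hb hD)
  have hδpos : 0 < δ := lt_min (by linarith) (by linarith)
  have hDpos : 0 < ‖D‖ := norm_pos_iff.2 hD
  refine ⟨δ * ‖D‖ / L, by positivity, ?_⟩
  have ev1 : ∀ᶠ z in 𝓝 t₁, ‖c * D‖ / 2 < ‖a * cross t₁ t₂ z - c * cross t₂ t₃ z‖ := by
    have hcont : Continuous fun z => ‖a * cross t₁ t₂ z - c * cross t₂ t₃ z‖ := by fun_prop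
    refine hcont.continuousAt.eventually_const_lt ?_
    beta_reduce
    rw [hx1, hw1, mul_zero, zero_sub, norm_neg]
    linarith
  have ev2 : ∀ᶠ z in 𝓝 t₁, ‖b * D‖ / 2 < ‖b * cross t₂ t₃ z - a * cross t₃ t₁ z‖ := by
    have hcont : Continuous fun z => ‖b * cross t₂ t₃ z - a * cross t₃ t₁ z‖ := by fun_prop
    refine hcont.continuousAt.eventually_const_lt ?_
    beta_reduce
    rw [hx1, hy1, mul_zero, sub_zero]
    linarith
  filter_upwards [ev1, ev2] with z h1 h2
  have e : D • (z - t₁) = cross t₃ t₁ z • (t₂ - t₁) + cross t₁ t₂ z • (t₃ - t₁) := by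
    ext i
    fin_cases i <;> simp [hDdef, cross] <;> ring
  have hn : ‖D‖ * ‖z - t₁‖ ≤ (‖cross t₃ t₁ z‖ + ‖cross t₁ t₂ z‖) * L := by
    rw [← norm_smul, e]
    refine (norm_add_le _ _).trans ?_
    rw [norm_smul, norm_smul, hL]
    nlinarith [norm_nonneg (cross t₃ t₁ z), norm_nonneg (cross t₁ t₂ z),
      mul_nonneg (norm_nonneg (cross t₃ t₁ z)) (norm_nonneg (t₃ - t₁)),
      mul_nonneg (norm_nonneg (cross t₁ t₂ z)) (norm_nonneg (t₂ - t₁))]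
  have hM : δ * (‖cross t₃ t₁ z‖ + ‖cross t₁ t₂ z‖) ≤ triangleDist t₁ t₂ t₃ p z := by
    have k1 : δ ≤ ‖a * cross t₁ t₂ z - c * cross t₂ t₃ z‖ := (min_le_left _ _).trans h1.le
    have k2 : δ ≤ ‖b * cross t₂ t₃ z - a * cross t₃ t₁ z‖ := (min_le_right _ _).trans h2.le
    unfold triangleDist cremonaDist
    simp only [norm_mul]
    have := mul_le_mul_of_nonneg_left k1 (norm_nonneg (cross t₃ t₁ z))
    have := mul_le_mul_of_nonneg_left k2 (norm_nonneg (cross t₁ t₂ z))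
    have : 0 ≤ ‖cross t₂ t₃ z‖ * ‖c * cross t₃ t₁ z - b * cross t₁ t₂ z‖ := by positivity
    linarith
  rw [div_mul_eq_mul_div, div_le_iff₀ hLpos, mul_assoc]
  calc δ * (‖D‖ * ‖z - t₁‖) ≤ δ * ((‖cross t₃ t₁ z‖ + ‖cross t₁ t₂ z‖) * L) := by gcongr
    _ = δ * (‖cross t₃ t₁ z‖ + ‖cross t₁ t₂ z‖) * L := by ring
    _ ≤ _ := by gcongr

/-- Near `p` no coordinate is small, so the distance dominates the plain vector product of the
coordinates of `p` and `z`. Both coordinate vectors have the same sum `D`, so differences of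
components of this product are `D` times the differences of coordinates. -/
theorem eventually_le_triangleDist_self {t₁ t₂ t₃ p : EuclideanSpace ℂ (Fin 2)}
    (hD : cross t₁ t₂ t₃ ≠ 0) (ha : cross t₂ t₃ p ≠ 0) (hb : cross t₃ t₁ p ≠ 0)
    (hc : cross t₁ t₂ p ≠ 0) :
    ∃ κ > 0, ∀ᶠ z in 𝓝 p, κ * ‖z - p‖ ≤ triangleDist t₁ t₂ t₃ p z := by
  have hsum := cross_add_cross_add_cross t₁ t₂ t₃ p
  set D := cross t₁ t₂ t₃ with hDdef
  have cx := continuous_cross t₂ t₃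
  have cy := continuous_cross t₃ t₁
  have cw := continuous_cross t₁ t₂
  have ha' := norm_pos_iff.2 ha
  have hb' := norm_pos_iff.2 hb
  have hc' := norm_pos_iff.2 hc
  have hD' := norm_pos_iff.2 hD
  have ev1 : ∀ᶠ z in 𝓝 p, ‖cross t₂ t₃ p‖ / 2 < ‖cross t₂ t₃ z‖ :=
    cx.norm.continuousAt.eventually_const_lt (by linarith)
  have ev2 : ∀ᶠ z in 𝓝 p, ‖cross t₃ t₁ p‖ / 2 < ‖cross t₃ t₁ z‖ :=
    cy.norm.continuousAt.eventually_const_lt (by linarith)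
  have ev3 : ∀ᶠ z in 𝓝 p, ‖cross t₁ t₂ p‖ / 2 < ‖cross t₁ t₂ z‖ :=
    cw.norm.continuousAt.eventually_const_lt (by linarith)
  set L := ‖t₁‖ + ‖t₂‖ + ‖t₃‖ + 1 with hL
  have hLpos : 0 < L := by positivity
  set δ := min (‖cross t₂ t₃ p‖ / 2) (min (‖cross t₃ t₁ p‖ / 2) (‖cross t₁ t₂ p‖ / 2))
  have hδpos : 0 < δ := lt_min (by linarith) (lt_min (by linarith) (by linarith))
  refine ⟨δ * ‖D‖ ^ 2 / L, by positivity, ?_⟩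
  filter_upwards [ev1, ev2, ev3] with z h1 h2 h3
  have hsumz := cross_add_cross_add_cross t₁ t₂ t₃ z
  have ez := cross_smul_eq t₁ t₂ t₃ z
  have ep := cross_smul_eq t₁ t₂ t₃ p
  rw [← hDdef] at hsumz ez ep
  have h1' : δ ≤ ‖cross t₂ t₃ z‖ := (min_le_left _ _).trans h1.le
  have h2' : δ ≤ ‖cross t₃ t₁ z‖ := (min_le_right _ _).trans ((min_le_left _ _).trans h2.le)
  have h3' : δ ≤ ‖cross t₁ t₂ z‖ := (min_le_right _ _).trans ((min_le_right _ _).trans h3.le)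
  set a := cross t₂ t₃ p
  set b := cross t₃ t₁ p
  set c := cross t₁ t₂ p
  set x := cross t₂ t₃ z with hx
  set y := cross t₃ t₁ z with hy
  set w := cross t₁ t₂ z with hw
  set e₁ := c * y - b * w with he₁
  set e₂ := a * w - c * x with he₂
  set e₃ := b * x - a * y with he₃
  have hM : δ * (‖e₁‖ + ‖e₂‖ + ‖e₃‖) ≤ triangleDist t₁ t₂ t₃ p z := by
    unfold triangleDist cremonaDist
    simp only [norm_mul]
    have := mul_le_mul_of_nonneg_right h1' (norm_nonneg e₁)
    have := mul_le_mul_of_nonneg_right h2' (norm_nonneg e₂)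
    have := mul_le_mul_of_nonneg_right h3' (norm_nonneg e₃)
    linarith
  have e : (D ^ 2) • (z - p) = (e₃ - e₂) • t₁ + (e₁ - e₃) • t₂ + (e₂ - e₁) • t₃ := by
    have f1 : e₃ - e₂ = D * (x - a) := by
      rw [he₃, he₂]; linear_combination x * hsum - a * hsumz
    have f2 : e₁ - e₃ = D * (y - b) := by
      rw [he₃, he₁]; linear_combination y * hsum - b * hsumz
    have f3 : e₂ - e₁ = D * (w - c) := by
      rw [he₁, he₂]; linear_combination w * hsum - c * hsumz
    rw [f1, f2, f3, sq, mul_smul, smul_sub, ez, ep]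
    module
  have hn : ‖D‖ ^ 2 * ‖z - p‖ ≤ (‖e₁‖ + ‖e₂‖ + ‖e₃‖) * L := by
    rw [← norm_pow, ← norm_smul, e]
    have n1 := norm_nonneg e₁
    have n2 := norm_nonneg e₂
    have n3 := norm_nonneg e₃
    calc _ ≤ ‖e₃ - e₂‖ * ‖t₁‖ + ‖e₁ - e₃‖ * ‖t₂‖ + ‖e₂ - e₁‖ * ‖t₃‖ := by
          simp only [← norm_smul]; exact norm_add₃_le
      _ ≤ (‖e₁‖ + ‖e₂‖ + ‖e₃‖) * ‖t₁‖ + (‖e₁‖ + ‖e₂‖ + ‖e₃‖) * ‖t₂‖ +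
          (‖e₁‖ + ‖e₂‖ + ‖e₃‖) * ‖t₃‖ := by
          gcongr
          · linarith [norm_sub_le e₃ e₂]
          · linarith [norm_sub_le e₁ e₃]
          · linarith [norm_sub_le e₂ e₁]
      _ ≤ _ := by rw [hL]; nlinarith
  rw [div_mul_eq_mul_div, div_le_iff₀ hLpos, mul_assoc]
  calc δ * (‖D‖ ^ 2 * ‖z - p‖) ≤ δ * ((‖e₁‖ + ‖e₂‖ + ‖e₃‖) * L) := by gcongr
    _ = δ * (‖e₁‖ + ‖e₂‖ + ‖e₃‖) * L := by ring
    _ ≤ _ := by gcongr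

/-- Growth of `cremonaDist` when two of the coordinates are of maximal size. -/
theorem norm_sq_le_cremonaDist_of_large {a b c x y w : ℂ} {m : ℝ} (hm : 0 < m)
    (hs : x + y + w = a + b + c) (hy : ‖y‖ ≤ m) (hw : ‖w‖ ≤ m) (hy' : m / 4 ≤ ‖y‖)
    (hw' : m / 4 ≤ ‖w‖) (hmc : 128 * ‖c‖ ≤ m) :
    ‖(a + b + c) * a‖ * m ^ 2 ≤
      128 * (‖a + b + c‖ + 2 * ‖c‖) * cremonaDist a b c x y w := by
  set D := a + b + c with hD
  set E₂ := y * (a * w - c * x) with hE₂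
  set E₃ := w * (b * x - a * y) with hE₃
  set M := cremonaDist a b c x y w with hM
  have n1 := norm_nonneg (x * (c * y - b * w))
  have n2 := norm_nonneg E₂
  have n3 := norm_nonneg E₃
  have hM2 : ‖E₂‖ ≤ M := by rw [hM]; unfold cremonaDist; linarith
  have hM3 : ‖E₃‖ ≤ M := by rw [hM]; unfold cremonaDist; linarith
  have hM0 : 0 ≤ M := n2.trans hM2
  -- Eliminating `x` by the fixed sum expresses the cubic monomial by `E₂`, `E₃` and a quadratic
  -- monomial. The latter is at most half of the left side since `|c| ≤ |w| / 2`. With `|y| |w|² ≥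
  -- m³ / 64` this gives the factor 128.
  have e : D * a * (y * w ^ 2) = D * w * E₂ + (c * (y * E₃ - w * E₂) + c * (D * a) * (y * w)) := by
    rw [hE₂, hE₃, hD]
    linear_combination (a * c * y * w) * hs
  have h1 : ‖D * a‖ * (‖y‖ * ‖w‖ ^ 2) ≤
      (‖D‖ + 2 * ‖c‖) * m * M + ‖c‖ * ‖D * a‖ * (‖y‖ * ‖w‖) := by
    have k1 : ‖D * w * E₂‖ ≤ ‖D‖ * m * M := by rw [norm_mul, norm_mul]; gcongr
    have k2 : ‖c * (y * E₃ - w * E₂)‖ ≤ ‖c‖ * (m * M + m * M) := by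
      rw [norm_mul]
      gcongr
      exact (norm_sub_le _ _).trans (add_le_add
        ((norm_mul_le _ _).trans (mul_le_mul hy hM3 n3 hm.le))
        ((norm_mul_le _ _).trans (mul_le_mul hw hM2 n2 hm.le)))
    have k3 : ‖c * (D * a) * (y * w)‖ = ‖c‖ * ‖D * a‖ * (‖y‖ * ‖w‖) := by
      simp only [norm_mul]
    calc ‖D * a‖ * (‖y‖ * ‖w‖ ^ 2) = ‖D * a * (y * w ^ 2)‖ := by simp only [norm_mul, norm_pow]
      _ ≤ ‖D * w * E₂‖ + (‖c * (y * E₃ - w * E₂)‖ + ‖c * (D * a) * (y * w)‖) := by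
          rw [e]
          exact (norm_add_le _ _).trans (by gcongr; exact norm_add_le _ _)
      _ ≤ _ := by rw [k3]; linarith
  have h2 : ‖c‖ * ‖D * a‖ * (‖y‖ * ‖w‖) ≤ ‖D * a‖ * (‖y‖ * ‖w‖ ^ 2) / 2 := by
    have : ‖c‖ ≤ ‖w‖ / 2 := by linarith [norm_nonneg c]
    calc _ ≤ ‖w‖ / 2 * ‖D * a‖ * (‖y‖ * ‖w‖) := by gcongr
      _ = _ := by ring
  have h3 : ‖D * a‖ * (m / 4 * (m / 4) ^ 2) ≤ ‖D * a‖ * (‖y‖ * ‖w‖ ^ 2) := by gcongr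
  have h4 : (‖D * a‖ * m ^ 2) * m ≤ (128 * (‖D‖ + 2 * ‖c‖) * M) * m := by nlinarith
  exact le_of_mul_le_mul_right h4 hm

/-- `cremonaDist` grows quadratically. -/
theorem exists_norm_sq_le_cremonaDist {a b c : ℂ} (ha : a ≠ 0) (hb : b ≠ 0) (hc : c ≠ 0)
    (hD : a + b + c ≠ 0) :
    ∃ κ > 0, ∃ R > 0, ∀ x y w : ℂ, x + y + w = a + b + c → ∀ m : ℝ, R ≤ m →
      ‖x‖ ≤ m → ‖y‖ ≤ m → ‖w‖ ≤ m → (m = ‖x‖ ∨ m = ‖y‖ ∨ m = ‖w‖) →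
      κ * m ^ 2 ≤ cremonaDist a b c x y w := by
  set D := a + b + c with hDdef
  have ha' := norm_pos_iff.2 ha
  have hb' := norm_pos_iff.2 hb
  have hc' := norm_pos_iff.2 hc
  have hD' := norm_pos_iff.2 hD
  set μ := min ‖a‖ (min ‖b‖ ‖c‖) with hμ
  have hμpos : 0 < μ := lt_min ha' (lt_min hb' hc')
  have hμa : μ ≤ ‖a‖ := min_le_left _ _
  have hμb : μ ≤ ‖b‖ := (min_le_right _ _).trans (min_le_left _ _)
  have hμc : μ ≤ ‖c‖ := (min_le_right _ _).trans (min_le_right _ _)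
  set K := 128 * (‖D‖ + 2 * (‖a‖ + ‖b‖ + ‖c‖)) with hK
  have hKpos : 0 < K := by positivity
  refine ⟨‖D‖ * μ / K, by positivity, 128 * (‖a‖ + ‖b‖ + ‖c‖ + ‖D‖), by positivity,
    fun x y w hs m hm hx hy hw hmax => ?_⟩
  have hm0 : 0 < m := lt_of_lt_of_le (by positivity) hm
  have hM0 : 0 ≤ cremonaDist a b c x y w := by unfold cremonaDist; positivity
  have fin : ∀ a' c' : ℂ, μ ≤ ‖a'‖ → ‖c'‖ ≤ ‖a‖ + ‖b‖ + ‖c‖ →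
      ‖D * a'‖ * m ^ 2 ≤ 128 * (‖D‖ + 2 * ‖c'‖) * cremonaDist a b c x y w →
      ‖D‖ * μ / K * m ^ 2 ≤ cremonaDist a b c x y w := by
    intro a' c' h1 h2 h3
    rw [div_mul_eq_mul_div, div_le_iff₀ hKpos]
    calc ‖D‖ * μ * m ^ 2 ≤ ‖D‖ * ‖a'‖ * m ^ 2 := by gcongr
      _ ≤ 128 * (‖D‖ + 2 * ‖c'‖) * cremonaDist a b c x y w := by rwa [← norm_mul]
      _ ≤ K * cremonaDist a b c x y w := by rw [hK]; gcongr
      _ = _ := mul_comm _ _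
  have hyw : m / 4 ≤ ‖y‖ → m / 4 ≤ ‖w‖ → ‖D‖ * μ / K * m ^ 2 ≤ cremonaDist a b c x y w := by
    intro h1 h2
    exact fin a c hμa (by linarith)
      (norm_sq_le_cremonaDist_of_large hm0 hs hy hw h1 h2 (by linarith))
  have hwx : m / 4 ≤ ‖w‖ → m / 4 ≤ ‖x‖ → ‖D‖ * μ / K * m ^ 2 ≤ cremonaDist a b c x y w := by
    intro h1 h2
    have := norm_sq_le_cremonaDist_of_large (a := b) (b := c) (c := a) (x := y) hm0
      (by rw [hDdef] at hs; linear_combination hs) hw hx h1 h2 (by linarith)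
    rw [cremonaDist_rotate, show b + c + a = D by rw [hDdef]; ring] at this
    exact fin b a hμb (by linarith) this
  have hxy : m / 4 ≤ ‖x‖ → m / 4 ≤ ‖y‖ → ‖D‖ * μ / K * m ^ 2 ≤ cremonaDist a b c x y w := by
    intro h1 h2
    have := norm_sq_le_cremonaDist_of_large (a := c) (b := a) (c := b) (x := w) hm0
      (by rw [hDdef] at hs; linear_combination hs) hx hy h1 h2 (by linarith)
    rw [cremonaDist_rotate, cremonaDist_rotate, show c + a + b = D by rw [hDdef]; ring] at this
    exact fin c b hμc (by linarith) this
  -- As the sum of the coordinates is fixed, a coordinate of large size `m` forces a second one of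
  -- size at least `m / 4`, which is the situation of `norm_sq_le_cremonaDist_of_large`.
  have tri : ∀ u v s : ℂ, u + v + s = D → ‖u‖ ≤ ‖D‖ + ‖v‖ + ‖s‖ := by
    intro u v s h
    have : u = D - v - s := by rw [← h]; ring
    rw [this]
    exact (norm_sub_le _ _).trans (by gcongr; exact norm_sub_le _ _)
  rcases hmax with h | h | h
  · have := tri x y w hs
    rcases le_or_gt (m / 4) ‖y‖ with h1 | h1
    · exact hxy (by linarith) h1
    · exact hwx (by linarith) (by linarith)
  · have := tri y w x (by rw [← hs]; ring)
    rcases le_or_gt (m / 4) ‖w‖ with h1 | h1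
    · exact hyw (by linarith) h1
    · exact hxy (by linarith) (by linarith)
  · have := tri w x y (by rw [← hs]; ring)
    rcases le_or_gt (m / 4) ‖x‖ with h1 | h1
    · exact hwx (by linarith) h1
    · exact hyw (by linarith) (by linarith)

/-- The point `z` is a linear combination of the vertices, so its largest barycentric coordinate is
at least a multiple of `‖z‖`. -/
theorem eventually_le_triangleDist_cobounded {t₁ t₂ t₃ p : EuclideanSpace ℂ (Fin 2)}
    (hD : cross t₁ t₂ t₃ ≠ 0) (ha : cross t₂ t₃ p ≠ 0) (hb : cross t₃ t₁ p ≠ 0)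
    (hc : cross t₁ t₂ p ≠ 0) :
    ∃ κ > 0, ∀ᶠ z in Bornology.cobounded (EuclideanSpace ℂ (Fin 2)),
      κ * ‖z‖ ^ 2 ≤ triangleDist t₁ t₂ t₃ p z := by
  have hsum := cross_add_cross_add_cross t₁ t₂ t₃ p
  obtain ⟨κ, hκ, R, hR, h⟩ := exists_norm_sq_le_cremonaDist ha hb hc (by rwa [hsum])
  have hD' := norm_pos_iff.2 hD
  set L := ‖t₁‖ + ‖t₂‖ + ‖t₃‖ + 1 with hL
  have hLpos : 0 < L := by positivity
  refine ⟨κ * (‖cross t₁ t₂ t₃‖ / L) ^ 2, by positivity, ?_⟩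
  have hev : ∀ᶠ z in Bornology.cobounded (EuclideanSpace ℂ (Fin 2)),
      R * L / ‖cross t₁ t₂ t₃‖ ≤ ‖z‖ :=
    tendsto_norm_cobounded_atTop.eventually_ge_atTop _
  filter_upwards [hev] with z hz
  set m := max ‖cross t₂ t₃ z‖ (max ‖cross t₃ t₁ z‖ ‖cross t₁ t₂ z‖) with hm
  have hx : ‖cross t₂ t₃ z‖ ≤ m := le_max_left _ _
  have hy : ‖cross t₃ t₁ z‖ ≤ m := (le_max_left _ _).trans (le_max_right _ _)
  have hw : ‖cross t₁ t₂ z‖ ≤ m := (le_max_right _ _).trans (le_max_right _ _)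
  have hm0 : 0 ≤ m := (norm_nonneg _).trans hx
  have hmax : m = ‖cross t₂ t₃ z‖ ∨ m = ‖cross t₃ t₁ z‖ ∨ m = ‖cross t₁ t₂ z‖ := by
    rcases max_choice ‖cross t₂ t₃ z‖ (max ‖cross t₃ t₁ z‖ ‖cross t₁ t₂ z‖) with h | h
    · exact Or.inl h
    · rcases max_choice ‖cross t₃ t₁ z‖ ‖cross t₁ t₂ z‖ with h' | h'
      · exact Or.inr (Or.inl (h.trans h'))
      · exact Or.inr (Or.inr (h.trans h'))
  have hzm : ‖cross t₁ t₂ t₃‖ * ‖z‖ ≤ m * L := by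
    rw [← norm_smul, cross_smul_eq]
    calc _ ≤ ‖cross t₂ t₃ z‖ * ‖t₁‖ + ‖cross t₃ t₁ z‖ * ‖t₂‖ + ‖cross t₁ t₂ z‖ * ‖t₃‖ := by
          simp only [← norm_smul]; exact norm_add₃_le
      _ ≤ m * ‖t₁‖ + m * ‖t₂‖ + m * ‖t₃‖ := by gcongr
      _ ≤ _ := by rw [hL]; linarith
  have hle : ‖cross t₁ t₂ t₃‖ / L * ‖z‖ ≤ m := by
    rw [div_mul_eq_mul_div, div_le_iff₀ hLpos]; exact hzm
  have hRm : R ≤ m := by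
    refine le_trans ?_ hle
    rw [div_le_iff₀ hD'] at hz
    rw [div_mul_eq_mul_div, le_div_iff₀ hLpos]
    linarith
  calc κ * (‖cross t₁ t₂ t₃‖ / L) ^ 2 * ‖z‖ ^ 2 = κ * (‖cross t₁ t₂ t₃‖ / L * ‖z‖) ^ 2 := by ring
    _ ≤ κ * m ^ 2 := by gcongr
    _ ≤ _ := h _ _ _ (by rw [hsum, cross_add_cross_add_cross]) m hRm hx hy hw hmax

/-! ### From two-sided polynomial bounds to logarithmic poles and growth. -/

section
variable {n : ℕ} {P Q : MvPolynomial (Fin n) ℂ}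

theorem hasLogPole_halfLogNormSq {p : EuclideanSpace ℂ (Fin n)} {k : ℕ} (hk : 0 < k) {c C : ℝ}
    (hc : 0 < c) (h1 : ∀ᶠ z in 𝓝 p, c * ‖z - p‖ ^ (2 * k) ≤
      ‖MvPolynomial.eval (fun i => z i) P‖ ^ 2 + ‖MvPolynomial.eval (fun i => z i) Q‖ ^ 2)
    (h2 : ∀ᶠ z in 𝓝 p, ‖MvPolynomial.eval (fun i => z i) P‖ ^ 2 +
      ‖MvPolynomial.eval (fun i => z i) Q‖ ^ 2 ≤ C * ‖z - p‖ ^ (2 * k)) :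
    HasLogPole (halfLogNormSq P Q) k p := by
  refine ⟨by exact_mod_cast hk, |Real.log c| + |Real.log C|, ?_⟩
  filter_upwards [h1, h2] with z h1 h2
  by_cases hz : z = p
  · subst hz
    have h0 : ‖MvPolynomial.eval (fun i => z i) P‖ ^ 2 +
        ‖MvPolynomial.eval (fun i => z i) Q‖ ^ 2 ≤ 0 := by
      rw [sub_self, norm_zero, zero_pow (by omega), mul_zero] at h2
      exact h2
    have hbot : halfLogNormSq P Q z = ⊥ := by
      rcases norm_sq_add_norm_sq_pos_or_eq_zero (MvPolynomial.eval (fun i => z i) P)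
        (MvPolynomial.eval (fun i => z i) Q) with h | ⟨h, h'⟩
      · exact absurd h h0.not_gt
      · exact halfLogNormSq_eq_bot h h'
    have hpos : (0 : ℝ) < (k : ℝ) := by exact_mod_cast hk
    rw [hbot, sub_self, enorm_zero, ENNReal.log_zero, EReal.coe_mul_bot_of_pos hpos]
    simp
  · have hd : 0 < ‖z - p‖ := norm_pos_iff.2 (sub_ne_zero.2 hz)
    have hlow : 0 < c * ‖z - p‖ ^ (2 * k) := by positivity
    have hN := hlow.trans_le h1
    -- Positivity of the upper constant is forced by the lower bound.
    have hCpos : 0 < C := pos_of_mul_pos_left (hN.trans_le h2) (by positivity)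
    rw [halfLogNormSq_eq_coe hN, ← ofReal_norm, ENNReal.log_ofReal_of_pos hd]
    have l1 := Real.log_le_log hlow h1
    have l2 := Real.log_le_log hN h2
    rw [Real.log_mul hc.ne' (by positivity), Real.log_pow] at l1
    rw [Real.log_mul hCpos.ne' (by positivity), Real.log_pow] at l2
    push_cast at l1 l2
    have a1 := neg_abs_le (Real.log c)
    have a2 := le_abs_self (Real.log C)
    have a3 := abs_nonneg (Real.log c)
    have a4 := abs_nonneg (Real.log C)
    constructor
    · rw [← EReal.coe_mul, ← EReal.coe_sub, EReal.coe_le_coe_iff]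
      linarith
    · rw [← EReal.coe_mul, ← EReal.coe_add, EReal.coe_le_coe_iff]
      linarith

theorem growthConstant_halfLogNormSq [Nontrivial (EuclideanSpace ℂ (Fin n))] {k : ℕ} {c C : ℝ}
    (hc : 0 < c)
    (h1 : ∀ᶠ z in Bornology.cobounded (EuclideanSpace ℂ (Fin n)), c * ‖z‖ ^ (2 * k) ≤
      ‖MvPolynomial.eval (fun i => z i) P‖ ^ 2 + ‖MvPolynomial.eval (fun i => z i) Q‖ ^ 2)
    (h2 : ∀ᶠ z in Bornology.cobounded (EuclideanSpace ℂ (Fin n)),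
      ‖MvPolynomial.eval (fun i => z i) P‖ ^ 2 +
        ‖MvPolynomial.eval (fun i => z i) Q‖ ^ 2 ≤ C * ‖z‖ ^ (2 * k)) :
    growthConstant (halfLogNormSq P Q) = k := by
  have hlog : Tendsto (fun z : EuclideanSpace ℂ (Fin n) => Real.log ‖z‖)
      (Bornology.cobounded _) atTop := Real.tendsto_log_atTop.comp tendsto_norm_cobounded_atTop
  have hbig : ∀ᶠ z in Bornology.cobounded (EuclideanSpace ℂ (Fin n)), 1 < ‖z‖ :=
    tendsto_norm_cobounded_atTop.eventually_gt_atTop 1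
  have hreal : Tendsto (fun z : EuclideanSpace ℂ (Fin n) =>
      (1 / 2 * Real.log (‖MvPolynomial.eval (fun i => z i) P‖ ^ 2 +
        ‖MvPolynomial.eval (fun i => z i) Q‖ ^ 2)) / Real.log ‖z‖)
      (Bornology.cobounded _) (𝓝 (k : ℝ)) := by
    have t1 : Tendsto (fun z : EuclideanSpace ℂ (Fin n) => 1 / 2 * Real.log c / Real.log ‖z‖ + k)
        (Bornology.cobounded _) (𝓝 (k : ℝ)) := by
      simpa using (tendsto_const_nhds.div_atTop hlog).add_const (k : ℝ)
    have t2 : Tendsto (fun z : EuclideanSpace ℂ (Fin n) => 1 / 2 * Real.log C / Real.log ‖z‖ + k)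
        (Bornology.cobounded _) (𝓝 (k : ℝ)) := by
      simpa using (tendsto_const_nhds.div_atTop hlog).add_const (k : ℝ)
    refine tendsto_of_tendsto_of_tendsto_of_le_of_le' t1 t2 ?_ ?_
    · filter_upwards [h1, hbig] with z h1 hz
      have hl := Real.log_pos hz
      have hlow : 0 < c * ‖z‖ ^ (2 * k) := by positivity
      have l1 := Real.log_le_log hlow h1
      rw [Real.log_mul hc.ne' (by positivity), Real.log_pow] at l1
      push_cast at l1
      rw [div_add' _ _ _ hl.ne']
      gcongr
      linarith
    · filter_upwards [h1, h2, hbig] with z h1 h2 hz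
      have hl := Real.log_pos hz
      have hlow : 0 < c * ‖z‖ ^ (2 * k) := by positivity
      have hN := hlow.trans_le h1
      have hCpos : 0 < C := pos_of_mul_pos_left (hN.trans_le h2) (by positivity)
      have l2 := Real.log_le_log hN h2
      rw [Real.log_mul hCpos.ne' (by positivity), Real.log_pow] at l2
      push_cast at l2
      rw [div_add' _ _ _ hl.ne']
      gcongr
      linarith
  have hE := (continuous_coe_real_ereal.tendsto (k : ℝ)).comp hreal
  unfold growthConstant
  have hcongr : Tendsto (fun z : EuclideanSpace ℂ (Fin n) =>
      halfLogNormSq P Q z / ((Real.log ‖z‖ : ℝ) : EReal)) (Bornology.cobounded _)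
      (𝓝 ((k : ℝ) : EReal)) := by
    refine hE.congr' ?_
    filter_upwards [h1, hbig] with z h1 hz
    have hlow : 0 < c * ‖z‖ ^ (2 * k) := by positivity
    rw [halfLogNormSq_eq_coe (hlow.trans_le h1), ← EReal.coe_div]
    rfl
  have : NeBot (Bornology.cobounded (EuclideanSpace ℂ (Fin n))) := NormedSpace.cobounded_neBot ℂ _
  rw [hcongr.limsup_eq]
  rfl

/-- A polynomial of degree at most `d` is `O(‖z‖ᵈ)` at infinity. -/
theorem exists_eventually_norm_eval_le {d : ℕ} (hP : P.totalDegree ≤ d) :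
    ∃ C > 0, ∀ᶠ z in Bornology.cobounded (EuclideanSpace ℂ (Fin n)),
      ‖MvPolynomial.eval (fun i => z i) P‖ ≤ C * ‖z‖ ^ d := by
  refine ⟨∑ m ∈ P.support, ‖P.coeff m‖ + 1, by positivity, ?_⟩
  have hbig : ∀ᶠ z in Bornology.cobounded (EuclideanSpace ℂ (Fin n)), 1 ≤ ‖z‖ :=
    tendsto_norm_cobounded_atTop.eventually_ge_atTop 1
  filter_upwards [hbig] with z hz
  rw [MvPolynomial.eval_eq, add_mul, Finset.sum_mul]
  refine (norm_sum_le _ _).trans (le_add_of_le_of_nonneg (Finset.sum_le_sum fun m hm => ?_)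
    (by positivity))
  rw [norm_mul]
  gcongr
  rw [norm_prod]
  calc ∏ i ∈ m.support, ‖z i ^ m i‖ ≤ ∏ i ∈ m.support, ‖z‖ ^ m i := by
        refine Finset.prod_le_prod (fun _ _ => norm_nonneg _) fun i _ => ?_
        rw [norm_pow]
        gcongr
        exact PiLp.norm_apply_le z i
    _ = ‖z‖ ^ (∑ i ∈ m.support, m i) := Finset.prod_pow_eq_pow_sum _ _ _
    _ ≤ ‖z‖ ^ d := pow_le_pow_right₀ hz ((MvPolynomial.le_totalDegree hm).trans hP)

/-- A polynomial vanishing at `p` is `O(‖z - p‖)` near `p`. -/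
theorem exists_eventually_norm_eval_le_norm_sub {p : EuclideanSpace ℂ (Fin n)}
    (hP : MvPolynomial.eval (fun i => p i) P = 0) :
    ∃ C > 0, ∀ᶠ z in 𝓝 p, ‖MvPolynomial.eval (fun i => z i) P‖ ≤ C * ‖z - p‖ := by
  obtain ⟨C, hC, h⟩ := (analyticAt_eval_euclidean P p).differentiableAt.isBigO_sub.exists_pos
  refine ⟨C, hC, h.bound.mono fun z hz => ?_⟩
  simpa [hP] using hz

end

/-! ### Coprimality from finiteness of the common zeros. -/

/-- Two bivariate polynomials with finitely many common zeros have no common factor. -/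
theorem isRelPrime_of_finite {P Q : MvPolynomial (Fin 2) ℂ}
    (S : Finset (EuclideanSpace ℂ (Fin 2)))
    (hS : ∀ z : EuclideanSpace ℂ (Fin 2), MvPolynomial.eval (fun i => z i) P = 0 →
      MvPolynomial.eval (fun i => z i) Q = 0 → z ∈ S) : IsRelPrime P Q := by
  intro d hdP hdQ
  have hdS : ∀ z : EuclideanSpace ℂ (Fin 2), MvPolynomial.eval (fun i => z i) d = 0 → z ∈ S := by
    intro z hz
    obtain ⟨e, rfl⟩ := hdP
    obtain ⟨f, rfl⟩ := hdQ
    exact hS z (by simp [hz]) (by simp [hz])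
  -- A common factor `d` vanishes only on `S`, as does a product `g` of factors `X i - s i`. By the
  -- Nullstellensatz `d` divides a power of `g`, which does not involve the other variable `X j`.
  -- Using both choices of `i`, the factor is constant.
  have key : ∀ i j : Fin 2, i ≠ j → d.degreeOf j = 0 := by
    intro i j hij
    set g : MvPolynomial (Fin 2) ℂ :=
      ∏ s ∈ S, (MvPolynomial.X i - MvPolynomial.C (s i)) with hg
    have hgne : g ≠ 0 := by
      rw [hg, Finset.prod_ne_zero_iff]
      intro s _ h0
      have := congrArg (MvPolynomial.eval fun _ => s i + 1) h0
      simp at this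
    have hg0 : ∀ s ∈ S, MvPolynomial.eval (fun i => s i) g = 0 := by
      intro s hs
      rw [hg, map_prod]
      exact Finset.prod_eq_zero hs (by simp)
    have hmem : g ∈ (Ideal.span {d}).radical := by
      rw [← MvPolynomial.vanishingIdeal_zeroLocus_eq_radical (K := ℂ),
        MvPolynomial.mem_vanishingIdeal_iff]
      intro x hx
      rw [MvPolynomial.mem_zeroLocus_iff] at hx
      have h1 := hx d (Ideal.mem_span_singleton_self d)
      have h2 := hdS (WithLp.toLp 2 x) (by simpa [MvPolynomial.coe_aeval_eq_eval] using h1)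
      simpa [MvPolynomial.coe_aeval_eq_eval] using hg0 _ h2
    obtain ⟨k, hk⟩ := hmem
    rw [Ideal.mem_span_singleton] at hk
    obtain ⟨e, he⟩ := hk
    have hne : d * e ≠ 0 := he ▸ pow_ne_zero k hgne
    have hdeg : (g ^ k).degreeOf j = 0 := by
      have hfac : ∀ s ∈ S, (MvPolynomial.X i - MvPolynomial.C (s i) :
          MvPolynomial (Fin 2) ℂ).degreeOf j = 0 := by
        intro s _
        have := MvPolynomial.degreeOf_sub_le j (MvPolynomial.X i) (MvPolynomial.C (s i) :
          MvPolynomial (Fin 2) ℂ)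
        rw [MvPolynomial.degreeOf_X_of_ne (by tauto), MvPolynomial.degreeOf_C] at this
        simpa using this
      have h1 : g.degreeOf j = 0 := by
        have := MvPolynomial.degreeOf_prod_le j S
          (fun s => (MvPolynomial.X i - MvPolynomial.C (s i) : MvPolynomial (Fin 2) ℂ))
        rw [Finset.sum_eq_zero hfac] at this
        exact Nat.le_zero.1 this
      have := MvPolynomial.degreeOf_pow_le j g k
      rw [h1, mul_zero] at this
      exact Nat.le_zero.1 this
    rw [he, MvPolynomial.degreeOf_mul_eq (left_ne_zero_of_mul hne) (right_ne_zero_of_mul hne)]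
      at hdeg
    omega
  have hdne : d ≠ 0 := by
    rintro rfl
    obtain ⟨z, hz⟩ := Infinite.exists_notMem_finset S
    exact hz (hdS z (by simp))
  have htd : d.totalDegree = 0 := by
    rw [MvPolynomial.totalDegree_eq_zero_iff]
    intro m hm i
    have hi : d.degreeOf i = 0 := by
      fin_cases i
      · exact key 1 0 (by decide)
      · exact key 0 1 (by decide)
    have := MvPolynomial.degreeOf_le_iff.1 hi.le m hm
    omega
  rw [MvPolynomial.totalDegree_eq_zero_iff_eq_C] at htd
  rw [htd]
  refine IsUnit.map _ (isUnit_iff_ne_zero.2 fun h0 => hdne ?_)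
  rw [htd, h0, map_zero]

/-! ### Conics through the triangle as polynomials. -/

/-- The conic through the vertices of the triangle `t₁ t₂ t₃` and the points `p` and `q`. -/
noncomputable def conicPoly (t₁ t₂ t₃ p q : EuclideanSpace ℂ (Fin 2)) : MvPolynomial (Fin 2) ℂ :=
  MvPolynomial.C (cross t₂ t₃ p * cross t₁ t₂ p * (cross t₂ t₃ q * cross t₃ t₁ q) -
      cross t₂ t₃ p * cross t₃ t₁ p * (cross t₂ t₃ q * cross t₁ t₂ q)) *
      (linePoly t₃ t₁ * linePoly t₁ t₂) +
    MvPolynomial.C (cross t₂ t₃ p * cross t₃ t₁ p * (cross t₃ t₁ q * cross t₁ t₂ q) -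
      cross t₃ t₁ p * cross t₁ t₂ p * (cross t₂ t₃ q * cross t₃ t₁ q)) *
      (linePoly t₂ t₃ * linePoly t₁ t₂) +
    MvPolynomial.C (cross t₃ t₁ p * cross t₁ t₂ p * (cross t₂ t₃ q * cross t₁ t₂ q) -
      cross t₂ t₃ p * cross t₁ t₂ p * (cross t₃ t₁ q * cross t₁ t₂ q)) *
      (linePoly t₂ t₃ * linePoly t₃ t₁)

/-- The point `p` lies on none of the sides of the triangle `t₁ t₂ t₃`. -/
def OffSides (t₁ t₂ t₃ p : EuclideanSpace ℂ (Fin 2)) : Prop :=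
  cross t₂ t₃ p ≠ 0 ∧ cross t₃ t₁ p ≠ 0 ∧ cross t₁ t₂ p ≠ 0

section
variable {t₁ t₂ t₃ p q r : EuclideanSpace ℂ (Fin 2)}

theorem eval_conicPoly (t₁ t₂ t₃ p q z : EuclideanSpace ℂ (Fin 2)) :
    MvPolynomial.eval (fun i => z i) (conicPoly t₁ t₂ t₃ p q) =
      conicForm (cross t₂ t₃ p) (cross t₃ t₁ p) (cross t₁ t₂ p)
        (cross t₂ t₃ q) (cross t₃ t₁ q) (cross t₁ t₂ q)
        (cross t₂ t₃ z) (cross t₃ t₁ z) (cross t₁ t₂ z) := by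
  simp only [conicPoly, conicForm, map_add, map_mul, eval_linePoly, MvPolynomial.eval_C]

theorem norm_eval_conicPoly_swap (t₁ t₂ t₃ p q z : EuclideanSpace ℂ (Fin 2)) :
    ‖MvPolynomial.eval (fun i => z i) (conicPoly t₁ t₂ t₃ p q)‖ =
      ‖MvPolynomial.eval (fun i => z i) (conicPoly t₁ t₂ t₃ q p)‖ := by
  rw [eval_conicPoly, eval_conicPoly, norm_conicForm_swap]

theorem totalDegree_conicPoly_le : (conicPoly t₁ t₂ t₃ p q).totalDegree ≤ 2 := by
  have h : ∀ (c : ℂ) (a b a' b' : EuclideanSpace ℂ (Fin 2)),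
      (MvPolynomial.C c * (linePoly a b * linePoly a' b')).totalDegree ≤ 2 := by
    intro c a b a' b'
    refine (MvPolynomial.totalDegree_mul _ _).trans ?_
    rw [MvPolynomial.totalDegree_C, zero_add]
    exact (MvPolynomial.totalDegree_mul _ _).trans
      (add_le_add (totalDegree_linePoly_le _ _) (totalDegree_linePoly_le _ _))
  exact (MvPolynomial.totalDegree_add _ _).trans (max_le
    ((MvPolynomial.totalDegree_add _ _).trans (max_le (h _ _ _ _ _) (h _ _ _ _ _))) (h _ _ _ _ _))

theorem eval_conicPoly_vertex₁ :
    MvPolynomial.eval (fun i => t₁ i) (conicPoly t₁ t₂ t₃ p q) = 0 := by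
  rw [eval_conicPoly, cross_self_left, cross_self_right]; simp [conicForm]

theorem eval_conicPoly_vertex₂ :
    MvPolynomial.eval (fun i => t₂ i) (conicPoly t₁ t₂ t₃ p q) = 0 := by
  rw [eval_conicPoly, cross_self_left, cross_self_right]; simp [conicForm]

theorem eval_conicPoly_vertex₃ :
    MvPolynomial.eval (fun i => t₃ i) (conicPoly t₁ t₂ t₃ p q) = 0 := by
  rw [eval_conicPoly, cross_self_left, cross_self_right]; simp [conicForm]

theorem eval_conicPoly_left :
    MvPolynomial.eval (fun i => p i) (conicPoly t₁ t₂ t₃ p q) = 0 := by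
  rw [eval_conicPoly]; unfold conicForm; ring

theorem eval_conicPoly_right :
    MvPolynomial.eval (fun i => q i) (conicPoly t₁ t₂ t₃ p q) = 0 := by
  rw [eval_conicPoly]; unfold conicForm; ring

/-- At the midpoint of a side only one of the three monomials survives. If the conic vanished at the
midpoints of two sides, the coordinates of `p` and `q` would be proportional, hence equal because
their sums agree. -/
theorem conicPoly_ne_zero (hD : cross t₁ t₂ t₃ ≠ 0) (hp : OffSides t₁ t₂ t₃ p)
    (hq : OffSides t₁ t₂ t₃ q) (hpq : p ≠ q) : conicPoly t₁ t₂ t₃ p q ≠ 0 := by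
  intro h0
  apply hpq
  have hmid : ∀ a b c : EuclideanSpace ℂ (Fin 2),
      cross a b ((1 / 2 : ℂ) • (b + c)) = cross a b c / 2 := by
    intro a b c; simp [cross]; ring
  have hmid' : ∀ a b c : EuclideanSpace ℂ (Fin 2),
      cross b a ((1 / 2 : ℂ) • (b + c)) = cross b a c / 2 := by
    intro a b c; simp [cross]; ring
  have hmid0 : ∀ b c : EuclideanSpace ℂ (Fin 2), cross b c ((1 / 2 : ℂ) • (b + c)) = 0 := by
    intro b c; simp [cross]; ring
  have r1 : cross t₂ t₃ t₁ = cross t₁ t₂ t₃ := cross_rotate _ _ _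
  have r2 : cross t₃ t₁ t₂ = cross t₁ t₂ t₃ := (cross_rotate _ _ _).trans r1
  have e1 := eval_conicPoly t₁ t₂ t₃ p q ((1 / 2 : ℂ) • (t₂ + t₃))
  have e2 := eval_conicPoly t₁ t₂ t₃ p q ((1 / 2 : ℂ) • (t₃ + t₁))
  rw [h0, map_zero, hmid0, hmid, add_comm t₂ t₃, hmid', r2] at e1
  rw [h0, map_zero, hmid0, hmid, add_comm t₃ t₁, hmid', r1] at e2
  have sp := cross_add_cross_add_cross t₁ t₂ t₃ p
  have sq := cross_add_cross_add_cross t₁ t₂ t₃ q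
  unfold conicForm at e1 e2
  set a := cross t₂ t₃ p
  set b := cross t₃ t₁ p
  set c := cross t₁ t₂ p
  set a' := cross t₂ t₃ q
  set b' := cross t₃ t₁ q
  set c' := cross t₁ t₂ q
  set D := cross t₁ t₂ t₃
  have f1 : c * b' = b * c' := by
    have h : a * a' * D ^ 2 ≠ 0 := mul_ne_zero (mul_ne_zero hp.1 hq.1) (pow_ne_zero _ hD)
    apply mul_left_cancel₀ h
    linear_combination -4 * e1
  have f2 : a * c' = c * a' := by
    have h : b * b' * D ^ 2 ≠ 0 := mul_ne_zero (mul_ne_zero hp.2.1 hq.2.1) (pow_ne_zero _ hD)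
    apply mul_left_cancel₀ h
    linear_combination -4 * e2
  have f3 : b * a' = a * b' := by
    apply mul_left_cancel₀ hp.2.2
    linear_combination -b * f2 - a * f1
  refine eq_of_cross_eq hD (mul_left_cancel₀ hD ?_) (mul_left_cancel₀ hD ?_)
    (mul_left_cancel₀ hD ?_)
  · change D * a = D * a'
    linear_combination a' * sp - a * sq + f2 - f3
  · change D * b = D * b'
    linear_combination b' * sp - b * sq + f3 - f1
  · change D * c = D * c'
    linear_combination c' * sp - c * sq + f1 - f2

theorem exists_triangleDist_le (hp : OffSides t₁ t₂ t₃ p)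
    (h : MvPolynomial.eval (fun i => r i) (conicPoly t₁ t₂ t₃ p q) ≠ 0) :
    ∃ K > 0, ∀ z : EuclideanSpace ℂ (Fin 2), triangleDist t₁ t₂ t₃ p z ≤
      K * (‖MvPolynomial.eval (fun i => z i) (conicPoly t₁ t₂ t₃ p q)‖ +
        ‖MvPolynomial.eval (fun i => z i) (conicPoly t₁ t₂ t₃ p r)‖) := by
  rw [eval_conicPoly] at h
  obtain ⟨K, hK, hle⟩ := exists_cremonaDist_le hp.1 hp.2.1 hp.2.2 h
  refine ⟨K, hK, fun z => ?_⟩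
  rw [eval_conicPoly, eval_conicPoly]
  exact hle _ _ _

theorem exists_eventually_le_conicPoly {l : Filter (EuclideanSpace ℂ (Fin 2))}
    {g : EuclideanSpace ℂ (Fin 2) → ℝ} (hp : OffSides t₁ t₂ t₃ p)
    (h : MvPolynomial.eval (fun i => r i) (conicPoly t₁ t₂ t₃ p q) ≠ 0)
    (hl : ∃ κ > 0, ∀ᶠ z in l, κ * g z ≤ triangleDist t₁ t₂ t₃ p z) :
    ∃ κ > 0, ∀ᶠ z in l, κ * g z ≤
      ‖MvPolynomial.eval (fun i => z i) (conicPoly t₁ t₂ t₃ p q)‖ +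
        ‖MvPolynomial.eval (fun i => z i) (conicPoly t₁ t₂ t₃ p r)‖ := by
  obtain ⟨K, hK, hle⟩ := exists_triangleDist_le hp h
  obtain ⟨κ, hκ, hev⟩ := hl
  refine ⟨κ / K, by positivity, hev.mono fun z hz => ?_⟩
  rw [div_mul_eq_mul_div, div_le_iff₀ hK, mul_comm _ K]
  exact hz.trans (hle z)

/-- The common points of two of the conics are the vertices of the triangle and `p`. -/
theorem eq_of_eval_conicPoly_eq_zero (hD : cross t₁ t₂ t₃ ≠ 0) (hp : OffSides t₁ t₂ t₃ p)
    (h : MvPolynomial.eval (fun i => r i) (conicPoly t₁ t₂ t₃ p q) ≠ 0)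
    {z : EuclideanSpace ℂ (Fin 2)}
    (h1 : MvPolynomial.eval (fun i => z i) (conicPoly t₁ t₂ t₃ p q) = 0)
    (h2 : MvPolynomial.eval (fun i => z i) (conicPoly t₁ t₂ t₃ p r) = 0) :
    z = t₁ ∨ z = t₂ ∨ z = t₃ ∨ z = p := by
  obtain ⟨K, hK, hle⟩ := exists_triangleDist_le hp h
  have h0 := hle z
  rw [h1, h2, norm_zero, add_zero, mul_zero] at h0
  have hnn : 0 ≤ triangleDist t₁ t₂ t₃ p z := by unfold triangleDist cremonaDist; positivity
  have sp := cross_add_cross_add_cross t₁ t₂ t₃ p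
  have sz := cross_add_cross_add_cross t₁ t₂ t₃ z
  have r1 : cross t₂ t₃ t₁ = cross t₁ t₂ t₃ := cross_rotate _ _ _
  have r2 : cross t₃ t₁ t₂ = cross t₁ t₂ t₃ := (cross_rotate _ _ _).trans r1
  rcases eq_of_cremonaDist_eq_zero hp.1 hp.2.1 hp.2.2 (by rwa [sp]) (by rw [sp, sz])
    (le_antisymm h0 hnn) with ⟨e1, e2, e3⟩ | ⟨e1, e2⟩ | ⟨e1, e2⟩ | ⟨e1, e2⟩
  · exact Or.inr (Or.inr (Or.inr (eq_of_cross_eq hD e1 e2 e3)))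
  · rw [e1, e2, add_zero, add_zero] at sz
    exact Or.inl (eq_of_cross_eq hD (by rw [sz, r1]) (by rw [e1, cross_self_right])
      (by rw [e2, cross_self_left]))
  · rw [e1, e2, add_zero, zero_add] at sz
    exact Or.inr (Or.inl (eq_of_cross_eq hD (by rw [e2, cross_self_left]) (by rw [sz, r2])
      (by rw [e1, cross_self_right])))
  · rw [e1, e2, zero_add, zero_add] at sz
    exact Or.inr (Or.inr (Or.inl (eq_of_cross_eq hD (by rw [e1, cross_self_right])
      (by rw [e2, cross_self_left]) sz)))

end

/-! ### Products of two conics. -/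

/-- Either `A` and `B` are both at least `m / 2`, or one of them is smaller and then `C` and `D`
both exceed `m / 2`. This turns bounds for pairs of conics into one for the two products. -/
theorem pow_four_le_of_le_add {A B C D m : ℝ} (hm : 0 ≤ m) (h1 : m ≤ A + C) (h2 : m ≤ A + D) (h3 : m ≤ B + C) (h4 : m ≤ B + D) :
    m ^ 4 / 16 ≤ (A * B) ^ 2 + (C * D) ^ 2 := by
  have key : ∀ x y : ℝ, m / 2 ≤ x → m / 2 ≤ y → m ^ 4 / 16 ≤ (x * y) ^ 2 := by
    intro x y hx hy
    calc m ^ 4 / 16 = (m / 2 * (m / 2)) ^ 2 := by ring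
      _ ≤ (x * y) ^ 2 := by gcongr; linarith
  rcases le_total (m / 2) A with hA2 | hA2
  · rcases le_total (m / 2) B with hB2 | hB2
    · linarith [key A B hA2 hB2, sq_nonneg (C * D)]
    · linarith [key C D (by linarith) (by linarith), sq_nonneg (A * B)]
  · linarith [key C D (by linarith) (by linarith), sq_nonneg (A * B)]

section
variable {X : Type*} {l : Filter X} {A B C D : X → ℂ} {g : X → ℝ}

theorem exists_eventually_pow_four_le (hg : ∀ z, 0 ≤ g z)
    (h1 : ∃ κ > 0, ∀ᶠ z in l, κ * g z ≤ ‖A z‖ + ‖C z‖)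
    (h2 : ∃ κ > 0, ∀ᶠ z in l, κ * g z ≤ ‖A z‖ + ‖D z‖)
    (h3 : ∃ κ > 0, ∀ᶠ z in l, κ * g z ≤ ‖B z‖ + ‖C z‖)
    (h4 : ∃ κ > 0, ∀ᶠ z in l, κ * g z ≤ ‖B z‖ + ‖D z‖) :
    ∃ κ > 0, ∀ᶠ z in l, κ * g z ^ 4 ≤ ‖A z * B z‖ ^ 2 + ‖C z * D z‖ ^ 2 := by
  obtain ⟨κ₁, hκ₁, h1⟩ := h1
  obtain ⟨κ₂, hκ₂, h2⟩ := h2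
  obtain ⟨κ₃, hκ₃, h3⟩ := h3
  obtain ⟨κ₄, hκ₄, h4⟩ := h4
  set κ := min (min κ₁ κ₂) (min κ₃ κ₄)
  have hκ : 0 < κ := lt_min (lt_min hκ₁ hκ₂) (lt_min hκ₃ hκ₄)
  refine ⟨κ ^ 4 / 16, by positivity, ?_⟩
  filter_upwards [h1, h2, h3, h4] with z h1 h2 h3 h4
  have hgz := hg z
  have := pow_four_le_of_le_add (mul_nonneg hκ.le hgz)
    (h1.trans' (mul_le_mul_of_nonneg_right ((min_le_left _ _).trans (min_le_left _ _)) hgz))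
    (h2.trans' (mul_le_mul_of_nonneg_right ((min_le_left _ _).trans (min_le_right _ _)) hgz))
    (h3.trans' (mul_le_mul_of_nonneg_right ((min_le_right _ _).trans (min_le_left _ _)) hgz))
    (h4.trans' (mul_le_mul_of_nonneg_right ((min_le_right _ _).trans (min_le_right _ _)) hgz))
  rw [norm_mul, norm_mul]
  calc κ ^ 4 / 16 * g z ^ 4 = (κ * g z) ^ 4 / 16 := by ring
    _ ≤ _ := this

theorem exists_eventually_le_pow_four
    (h1 : ∃ K > 0, ∀ᶠ z in l, ‖A z‖ ≤ K * g z) (h2 : ∃ K > 0, ∀ᶠ z in l, ‖B z‖ ≤ K * g z)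
    (h3 : ∃ K > 0, ∀ᶠ z in l, ‖C z‖ ≤ K * g z) (h4 : ∃ K > 0, ∀ᶠ z in l, ‖D z‖ ≤ K * g z) :
    ∃ K, ∀ᶠ z in l, ‖A z * B z‖ ^ 2 + ‖C z * D z‖ ^ 2 ≤ K * g z ^ 4 := by
  obtain ⟨κ₁, -, h1⟩ := h1
  obtain ⟨κ₂, -, h2⟩ := h2
  obtain ⟨κ₃, -, h3⟩ := h3
  obtain ⟨κ₄, -, h4⟩ := h4
  refine ⟨(κ₁ * κ₂) ^ 2 + (κ₃ * κ₄) ^ 2, ?_⟩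
  filter_upwards [h1, h2, h3, h4] with z h1 h2 h3 h4
  rw [norm_mul, norm_mul]
  have i1 := mul_le_mul h1 h2 (norm_nonneg _) ((norm_nonneg _).trans h1)
  have i2 := mul_le_mul h3 h4 (norm_nonneg _) ((norm_nonneg _).trans h3)
  calc _ ≤ (κ₁ * g z * (κ₂ * g z)) ^ 2 + (κ₃ * g z * (κ₄ * g z)) ^ 2 := by gcongr
    _ = _ := by ring

end

/-- A simple logarithmic pole at a transversal intersection of two curves. -/
theorem hasLogPole_one_of_transversal {n : ℕ} {A B C D : MvPolynomial (Fin n) ℂ}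
    {p : EuclideanSpace ℂ (Fin n)} (hA : MvPolynomial.eval (fun i => p i) A = 0)
    (hC : MvPolynomial.eval (fun i => p i) C = 0) (hB : MvPolynomial.eval (fun i => p i) B ≠ 0)
    (hD : MvPolynomial.eval (fun i => p i) D ≠ 0)
    (h : ∃ κ > 0, ∀ᶠ z in 𝓝 p, κ * ‖z - p‖ ≤ ‖MvPolynomial.eval (fun i => z i) A‖ +
      ‖MvPolynomial.eval (fun i => z i) C‖) :
    HasLogPole (halfLogNormSq (A * B) (C * D)) 1 p := by
  obtain ⟨κ, hκ, h⟩ := h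
  obtain ⟨KA, hKA, hA'⟩ := exists_eventually_norm_eval_le_norm_sub hA
  obtain ⟨KC, hKC, hC'⟩ := exists_eventually_norm_eval_le_norm_sub hC
  set b := ‖MvPolynomial.eval (fun i => p i) B‖ with hb
  set d := ‖MvPolynomial.eval (fun i => p i) D‖ with hd
  have hbpos : 0 < b := norm_pos_iff.2 hB
  have hdpos : 0 < d := norm_pos_iff.2 hD
  have cB := (continuous_eval_euclidean B).norm.continuousAt (x := p)
  have cD := (continuous_eval_euclidean D).norm.continuousAt (x := p)
  have b1 := cB.eventually_const_lt (show b / 2 < b by linarith)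
  have b2 := cB.eventually_lt_const (show b < 2 * b by linarith)
  have d1 := cD.eventually_const_lt (show d / 2 < d by linarith)
  have d2 := cD.eventually_lt_const (show d < 2 * d by linarith)
  set δ := min (b / 2) (d / 2)
  have hδ : 0 < δ := lt_min (by linarith) (by linarith)
  have := hasLogPole_halfLogNormSq (P := A * B) (Q := C * D) (p := p) (k := 1) one_pos
    (c := (δ * κ) ^ 2 / 2) (C := (KA * (2 * b)) ^ 2 + (KC * (2 * d)) ^ 2) (by positivity) ?_ ?_
  · simpa using this
  · filter_upwards [h, b1, d1] with z h b1 d1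
    rw [map_mul, map_mul, norm_mul, norm_mul]
    set α := ‖MvPolynomial.eval (fun i => z i) A‖
    set γ := ‖MvPolynomial.eval (fun i => z i) C‖
    have hα : 0 ≤ α := norm_nonneg _
    have hγ : 0 ≤ γ := norm_nonneg _
    have i1 := mul_le_mul_of_nonneg_left ((min_le_left (b / 2) (d / 2)).trans b1.le) hα
    have i2 := mul_le_mul_of_nonneg_left ((min_le_right (b / 2) (d / 2)).trans d1.le) hγ
    calc (δ * κ) ^ 2 / 2 * ‖z - p‖ ^ (2 * 1) = δ ^ 2 * (κ * ‖z - p‖) ^ 2 / 2 := by ring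
      _ ≤ δ ^ 2 * (α + γ) ^ 2 / 2 := by gcongr
      _ ≤ (α * δ) ^ 2 + (γ * δ) ^ 2 := by nlinarith [mul_nonneg (sq_nonneg δ) (sq_nonneg (α - γ))]
      _ ≤ _ := by gcongr
  · filter_upwards [hA', hC', b2, d2] with z hA' hC' b2 d2
    rw [map_mul, map_mul, norm_mul, norm_mul]
    calc _ ≤ (KA * ‖z - p‖ * (2 * b)) ^ 2 + (KC * ‖z - p‖ * (2 * d)) ^ 2 := by gcongr
      _ = _ := by ring

section
variable {S : Finset (EuclideanSpace ℂ (Fin 2))} {t₁ t₂ t₃ : EuclideanSpace ℂ (Fin 2)}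

/-- The conics through the triangle and two further points of `S` contain no sixth point of `S`. -/
theorem eval_conicPoly_ne_zero (hm : maxPointsOnCurve 2 S = 5)
    (h₁ : t₁ ∈ S) (h₂ : t₂ ∈ S) (h₃ : t₃ ∈ S) (h12 : t₁ ≠ t₂) (h13 : t₁ ≠ t₃) (h23 : t₂ ≠ t₃)
    (hD : cross t₁ t₂ t₃ ≠ 0) {p q r : EuclideanSpace ℂ (Fin 2)}
    (hpS : p ∈ S ∧ p ≠ t₁ ∧ p ≠ t₂ ∧ p ≠ t₃) (hqS : q ∈ S ∧ q ≠ t₁ ∧ q ≠ t₂ ∧ q ≠ t₃)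
    (hrS : r ∈ S ∧ r ≠ t₁ ∧ r ≠ t₂ ∧ r ≠ t₃)
    (hp : OffSides t₁ t₂ t₃ p) (hq : OffSides t₁ t₂ t₃ q) (hpq : p ≠ q) (hpr : p ≠ r)
    (hqr : q ≠ r) : MvPolynomial.eval (fun i => r i) (conicPoly t₁ t₂ t₃ p q) ≠ 0 := by
  classical
  intro h
  refine conicPoly_ne_zero hD hp hq hpq (eq_zero_of_totalDegree_le_two hm totalDegree_conicPoly_le
    [t₁, t₂, t₃, p, q, r].toFinset ?_ ?_ ?_)
  · intro w hw
    simp only [List.mem_toFinset, List.mem_cons, List.not_mem_nil, or_false] at hw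
    rcases hw with rfl | rfl | rfl | rfl | rfl | rfl
    exacts [h₁, h₂, h₃, hpS.1, hqS.1, hrS.1]
  · have hn : [t₁, t₂, t₃, p, q, r].Nodup := by
      simp only [List.nodup_cons, List.mem_cons, List.not_mem_nil]
      clear h hp hq hD hm
      grind
    rw [List.toFinset_card_of_nodup hn]
    simp
  · intro w hw
    simp only [List.mem_toFinset, List.mem_cons, List.not_mem_nil, or_false] at hw
    rcases hw with rfl | rfl | rfl | rfl | rfl | rfl
    exacts [eval_conicPoly_vertex₁, eval_conicPoly_vertex₂, eval_conicPoly_vertex₃,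
      eval_conicPoly_left, eval_conicPoly_right, h]

/-- If the degree were at most 1, multiplying by the line through `r` and `t₁` would give a nonzero
polynomial of degree at most 2 vanishing at six points of `S`. -/
theorem totalDegree_conicPoly (hm : maxPointsOnCurve 2 S = 5)
    (h₁ : t₁ ∈ S) (h₂ : t₂ ∈ S) (h₃ : t₃ ∈ S) (h12 : t₁ ≠ t₂) (h13 : t₁ ≠ t₃) (h23 : t₂ ≠ t₃)
    (hD : cross t₁ t₂ t₃ ≠ 0) {p q r : EuclideanSpace ℂ (Fin 2)}
    (hpS : p ∈ S ∧ p ≠ t₁ ∧ p ≠ t₂ ∧ p ≠ t₃) (hqS : q ∈ S ∧ q ≠ t₁ ∧ q ≠ t₂ ∧ q ≠ t₃)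
    (hrS : r ∈ S ∧ r ≠ t₁ ∧ r ≠ t₂ ∧ r ≠ t₃)
    (hp : OffSides t₁ t₂ t₃ p) (hq : OffSides t₁ t₂ t₃ q) (hpq : p ≠ q) (hpr : p ≠ r)
    (hqr : q ≠ r) : (conicPoly t₁ t₂ t₃ p q).totalDegree = 2 := by
  classical
  refine le_antisymm totalDegree_conicPoly_le ?_
  by_contra! hlt
  have hne := conicPoly_ne_zero hD hp hq hpq
  have hline : linePoly r t₁ ≠ 0 := linePoly_ne_zero hrS.2.1
  refine mul_ne_zero hne hline (eq_zero_of_totalDegree_le_two hm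
    ((MvPolynomial.totalDegree_mul _ _).trans
      (add_le_add (Nat.lt_succ_iff.1 hlt) (totalDegree_linePoly_le r t₁)))
    [t₁, t₂, t₃, p, q, r].toFinset ?_ ?_ ?_)
  · intro w hw
    simp only [List.mem_toFinset, List.mem_cons, List.not_mem_nil, or_false] at hw
    rcases hw with rfl | rfl | rfl | rfl | rfl | rfl
    exacts [h₁, h₂, h₃, hpS.1, hqS.1, hrS.1]
  · have hn : [t₁, t₂, t₃, p, q, r].Nodup := by
      simp only [List.nodup_cons, List.mem_cons, List.not_mem_nil]
      clear hlt hne hline hp hq hD hm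
      grind
    rw [List.toFinset_card_of_nodup hn]
    simp
  · intro w hw
    rw [map_mul]
    simp only [List.mem_toFinset, List.mem_cons, List.not_mem_nil, or_false] at hw
    rcases hw with rfl | rfl | rfl | rfl | rfl | rfl
    · rw [eval_conicPoly_vertex₁, zero_mul]
    · rw [eval_conicPoly_vertex₂, zero_mul]
    · rw [eval_conicPoly_vertex₃, zero_mul]
    · rw [eval_conicPoly_left, zero_mul]
    · rw [eval_conicPoly_right, zero_mul]
    · rw [eval_linePoly, cross_self_left, mul_zero]

end

/-! ### The Green function. -/

/-- `½ log (|P|² + |Q|²)` is an entire Green function of the common zeros of `P` and `Q`. -/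
theorem isEntireGreenFunction_halfLogNormSq {P Q : MvPolynomial (Fin 2) ℂ}
    {S : Finset (EuclideanSpace ℂ (Fin 2))}
    (hS : ∀ z : EuclideanSpace ℂ (Fin 2), z ∈ S ↔ MvPolynomial.eval (fun i => z i) P = 0 ∧
      MvPolynomial.eval (fun i => z i) Q = 0)
    (hgrowth : growthConstant (halfLogNormSq P Q) < ⊤) :
    IsEntireGreenFunction S (halfLogNormSq P Q) := by
  have hpos : ∀ z ∈ (S : Set (EuclideanSpace ℂ (Fin 2)))ᶜ,
      0 < ‖MvPolynomial.eval (fun i => z i) P‖ ^ 2 +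
        ‖MvPolynomial.eval (fun i => z i) Q‖ ^ 2 := by
    intro z hz
    rcases norm_sq_add_norm_sq_pos_or_eq_zero (MvPolynomial.eval (fun i => z i) P)
      (MvPolynomial.eval (fun i => z i) Q) with h | h
    · exact h
    · exact absurd ((hS z).2 h) hz
  refine ⟨plurisubharmonicOn_halfLogNormSq P Q _, hgrowth, fun z hz => ?_,
    isMaximalPSHOn_halfLogNormSq hpos, fun p hp =>
      halfLogNormSq_eq_bot ((hS p).1 hp).1 ((hS p).1 hp).2⟩
  have hu := halfLogNormSq_eq_coe (hpos z hz)
  set U := 1 / 2 * Real.log (‖MvPolynomial.eval (fun i => z i) P‖ ^ 2 +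
    ‖MvPolynomial.eval (fun i => z i) Q‖ ^ 2)
  have hcont := (continuous_halfLogNormSq P Q).continuousAt (x := z)
  refine ⟨|U| + 1, ?_⟩
  have h1 : ((-(|U| + 1) : ℝ) : EReal) < halfLogNormSq P Q z := by
    rw [hu, EReal.coe_lt_coe_iff]; linarith [neg_abs_le U]
  have h2 : halfLogNormSq P Q z < ((|U| + 1 : ℝ) : EReal) := by
    rw [hu, EReal.coe_lt_coe_iff]; linarith [le_abs_self U]
  filter_upwards [hcont.eventually_const_lt h1, hcont.eventually_lt_const h2] with w h1 h2
  exact ⟨h1.le, h2.le⟩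

theorem proposition2p3 (S : Finset (EuclideanSpace ℂ (Fin 2))) (hcard : S.card = 7)
    (hm : maxPointsOnCurve 2 S = 5) :
    ∃ u : EuclideanSpace ℂ (Fin 2) → EReal,
      IsEntireGreenFunction S u ∧
      growthConstant u = 4 ∧
      (∃ T ⊆ S, T.card = 3 ∧ (∀ p ∈ T, HasLogPole u 2 p) ∧
        ∀ p ∈ S, p ∉ T → HasLogPole u 1 p) ∧
      ∃ P₁ P₂ : MvPolynomial (Fin 2) ℂ,
        P₁.totalDegree = 4 ∧ P₂.totalDegree = 4 ∧ IsRelPrime P₁ P₂ ∧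
        ∀ z : EuclideanSpace ℂ (Fin 2),
          u z = ((1 / 2 : ℝ) : EReal) *
            ENNReal.log (‖MvPolynomial.eval (fun i => z i) P₁‖ₑ ^ 2 +
              ‖MvPolynomial.eval (fun i => z i) P₂‖ₑ ^ 2) := by
  classical
  obtain ⟨t₁, h₁, t₂, h₂, t₃, h₃, h12, h13, h23, hD, hoff⟩ := exists_triangle hcard hm
  have hT3 : ({t₁, t₂, t₃} : Finset (EuclideanSpace ℂ (Fin 2))).card = 3 :=
    Finset.card_eq_three.2 ⟨t₁, t₂, t₃, h12, h13, h23, rfl⟩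
  have hTS : ({t₁, t₂, t₃} : Finset (EuclideanSpace ℂ (Fin 2))) ⊆ S := by
    intro w hw
    simp only [Finset.mem_insert, Finset.mem_singleton] at hw
    rcases hw with rfl | rfl | rfl
    exacts [h₁, h₂, h₃]
  have hcard4 : (S \ {t₁, t₂, t₃}).card = 3 + 1 := by
    rw [Finset.card_sdiff_of_subset hTS, hT3, hcard]
  obtain ⟨p₁, U, hp₁U, hU, hUc⟩ := Finset.card_eq_succ.1 hcard4
  obtain ⟨p₂, p₃, p₄, h23', h24', h34', rfl⟩ := Finset.card_eq_three.1 hUc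
  simp only [Finset.mem_insert, Finset.mem_singleton, not_or] at hp₁U
  obtain ⟨n12, n13, n14⟩ := hp₁U
  have hmem : ∀ w, (w ∈ S ∧ w ≠ t₁ ∧ w ≠ t₂ ∧ w ≠ t₃) ↔ w = p₁ ∨ w = p₂ ∨ w = p₃ ∨ w = p₄ := by
    intro w
    have := Finset.ext_iff.1 hU w
    simp only [Finset.mem_sdiff, Finset.mem_insert, Finset.mem_singleton, not_or] at this
    exact this.symm
  have s1 := (hmem p₁).2 (Or.inl rfl)
  have s2 := (hmem p₂).2 (Or.inr (Or.inl rfl))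
  have s3 := (hmem p₃).2 (Or.inr (Or.inr (Or.inl rfl)))
  have s4 := (hmem p₄).2 (Or.inr (Or.inr (Or.inr rfl)))
  have o1 : OffSides t₁ t₂ t₃ p₁ := hoff p₁ s1.1 s1.2.1 s1.2.2.1 s1.2.2.2
  have o2 : OffSides t₁ t₂ t₃ p₂ := hoff p₂ s2.1 s2.2.1 s2.2.2.1 s2.2.2.2
  have o3 : OffSides t₁ t₂ t₃ p₃ := hoff p₃ s3.1 s3.2.1 s3.2.2.1 s3.2.2.2
  have o4 : OffSides t₁ t₂ t₃ p₄ := hoff p₄ s4.1 s4.2.1 s4.2.2.1 s4.2.2.2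
  have hne : ∀ {p q r : EuclideanSpace ℂ (Fin 2)}, (p ∈ S ∧ p ≠ t₁ ∧ p ≠ t₂ ∧ p ≠ t₃) →
      (q ∈ S ∧ q ≠ t₁ ∧ q ≠ t₂ ∧ q ≠ t₃) → (r ∈ S ∧ r ≠ t₁ ∧ r ≠ t₂ ∧ r ≠ t₃) →
      p ≠ q → p ≠ r → q ≠ r →
      MvPolynomial.eval (fun i => r i) (conicPoly t₁ t₂ t₃ p q) ≠ 0 :=
    fun {p q r} hp hq hr hpq hpr hqr => eval_conicPoly_ne_zero hm h₁ h₂ h₃ h12 h13 h23 hD hp hq hr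
      (hoff p hp.1 hp.2.1 hp.2.2.1 hp.2.2.2) (hoff q hq.1 hq.2.1 hq.2.2.1 hq.2.2.2) hpq hpr hqr
  have hdeg : ∀ {p q r : EuclideanSpace ℂ (Fin 2)}, (p ∈ S ∧ p ≠ t₁ ∧ p ≠ t₂ ∧ p ≠ t₃) →
      (q ∈ S ∧ q ≠ t₁ ∧ q ≠ t₂ ∧ q ≠ t₃) → (r ∈ S ∧ r ≠ t₁ ∧ r ≠ t₂ ∧ r ≠ t₃) →
      p ≠ q → p ≠ r → q ≠ r → (conicPoly t₁ t₂ t₃ p q).totalDegree = 2 :=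
    fun {p q r} hp hq hr hpq hpr hqr => totalDegree_conicPoly hm h₁ h₂ h₃ h12 h13 h23 hD hp hq hr
      (hoff p hp.1 hp.2.1 hp.2.2.1 hp.2.2.2) (hoff q hq.1 hq.2.1 hq.2.2.1 hq.2.2.2) hpq hpr hqr
  -- The pairs of indices form a 4-cycle, so each `pᵢ` lies on exactly one of `A, B` and one of `C,
  -- E`.
  set A := conicPoly t₁ t₂ t₃ p₁ p₂ with hA
  set B := conicPoly t₁ t₂ t₃ p₃ p₄ with hB
  set C := conicPoly t₁ t₂ t₃ p₁ p₃ with hC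
  set E := conicPoly t₁ t₂ t₃ p₂ p₄ with hE
  -- The point common to the two conics of a pair is listed first, as the distance estimates
  -- require. `norm_eval_conicPoly_swap` later restores the order used in `A, B, C, E`.
  have q1 : MvPolynomial.eval (fun i => p₃ i) (conicPoly t₁ t₂ t₃ p₁ p₂) ≠ 0 :=
    hne s1 s2 s3 n12 n13 h23'
  have q2 : MvPolynomial.eval (fun i => p₄ i) (conicPoly t₁ t₂ t₃ p₂ p₁) ≠ 0 :=
    hne s2 s1 s4 (Ne.symm n12) h24' n14
  have q3 : MvPolynomial.eval (fun i => p₁ i) (conicPoly t₁ t₂ t₃ p₃ p₄) ≠ 0 :=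
    hne s3 s4 s1 h34' (Ne.symm n13) (Ne.symm n14)
  have q4 : MvPolynomial.eval (fun i => p₂ i) (conicPoly t₁ t₂ t₃ p₄ p₃) ≠ 0 :=
    hne s4 s3 s2 (Ne.symm h34') (Ne.symm h24') (Ne.symm h23')
  -- The filter and the gauge are left free: the same bounds are used at infinity with `‖z‖²`, and
  -- near the points of `S` with the distance to the point.
  have pairs : ∀ (l : Filter (EuclideanSpace ℂ (Fin 2))) (g : EuclideanSpace ℂ (Fin 2) → ℝ),
      (OffSides t₁ t₂ t₃ p₁ → (∃ κ > 0, ∀ᶠ z in l, κ * g z ≤ triangleDist t₁ t₂ t₃ p₁ z) →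
        ∃ κ > 0, ∀ᶠ z in l, κ * g z ≤ ‖MvPolynomial.eval (fun i => z i) A‖ +
          ‖MvPolynomial.eval (fun i => z i) C‖) ∧
      (OffSides t₁ t₂ t₃ p₂ → (∃ κ > 0, ∀ᶠ z in l, κ * g z ≤ triangleDist t₁ t₂ t₃ p₂ z) →
        ∃ κ > 0, ∀ᶠ z in l, κ * g z ≤ ‖MvPolynomial.eval (fun i => z i) A‖ +
          ‖MvPolynomial.eval (fun i => z i) E‖) ∧
      (OffSides t₁ t₂ t₃ p₃ → (∃ κ > 0, ∀ᶠ z in l, κ * g z ≤ triangleDist t₁ t₂ t₃ p₃ z) →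
        ∃ κ > 0, ∀ᶠ z in l, κ * g z ≤ ‖MvPolynomial.eval (fun i => z i) B‖ +
          ‖MvPolynomial.eval (fun i => z i) C‖) ∧
      (OffSides t₁ t₂ t₃ p₄ → (∃ κ > 0, ∀ᶠ z in l, κ * g z ≤ triangleDist t₁ t₂ t₃ p₄ z) →
        ∃ κ > 0, ∀ᶠ z in l, κ * g z ≤ ‖MvPolynomial.eval (fun i => z i) B‖ +
          ‖MvPolynomial.eval (fun i => z i) E‖) := by
    intro l g
    refine ⟨fun o h => exists_eventually_le_conicPoly o q1 h, fun o h => ?_, fun o h => ?_,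
      fun o h => ?_⟩
    · simpa only [norm_eval_conicPoly_swap t₁ t₂ t₃ p₂ p₁] using
        exists_eventually_le_conicPoly o q2 h
    · simpa only [norm_eval_conicPoly_swap t₁ t₂ t₃ p₃ p₁] using
        exists_eventually_le_conicPoly o q3 h
    · simpa only [norm_eval_conicPoly_swap t₁ t₂ t₃ p₄ p₃, norm_eval_conicPoly_swap t₁ t₂ t₃ p₄ p₂]
        using exists_eventually_le_conicPoly o q4 h
  have evl : ∀ (X Y : MvPolynomial (Fin 2) ℂ) (z : EuclideanSpace ℂ (Fin 2)),
      MvPolynomial.eval (fun i => z i) (X * Y) =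
        MvPolynomial.eval (fun i => z i) X * MvPolynomial.eval (fun i => z i) Y :=
    fun X Y z => map_mul _ _ _
  have hzero : ∀ z : EuclideanSpace ℂ (Fin 2), z ∈ S ↔
      MvPolynomial.eval (fun i => z i) (A * B) = 0 ∧
        MvPolynomial.eval (fun i => z i) (C * E) = 0 := by
    intro z
    constructor
    · intro hz
      rw [evl, evl]
      by_cases hz1 : z = t₁
      · subst hz1; simp [hA, hC, eval_conicPoly_vertex₁]
      by_cases hz2 : z = t₂
      · subst hz2; simp [hA, hC, eval_conicPoly_vertex₂]
      by_cases hz3 : z = t₃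
      · subst hz3; simp [hA, hC, eval_conicPoly_vertex₃]
      rcases (hmem z).1 ⟨hz, hz1, hz2, hz3⟩ with rfl | rfl | rfl | rfl <;>
        simp [hA, hB, hC, hE, eval_conicPoly_left, eval_conicPoly_right]
    · rintro ⟨e1, e2⟩
      rw [evl, mul_eq_zero] at e1 e2
      have fin : ∀ p ∈ S, (z = t₁ ∨ z = t₂ ∨ z = t₃ ∨ z = p) → z ∈ S := by
        rintro p hp (rfl | rfl | rfl | rfl) <;> assumption
      have swap : ∀ p q, MvPolynomial.eval (fun i => z i) (conicPoly t₁ t₂ t₃ p q) = 0 →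
          MvPolynomial.eval (fun i => z i) (conicPoly t₁ t₂ t₃ q p) = 0 := fun p q h =>
        norm_eq_zero.1 (by rw [norm_eval_conicPoly_swap, h, norm_zero])
      -- The four pairs `(A, C)`, `(A, E)`, `(B, C)`, `(B, E)` add the points `p₁, p₂, p₃, p₄` to
      -- the triangle.
      rcases e1 with e1 | e1 <;> rcases e2 with e2 | e2
      · exact fin p₁ s1.1 (eq_of_eval_conicPoly_eq_zero hD o1 q1 e1 e2)
      · exact fin p₂ s2.1 (eq_of_eval_conicPoly_eq_zero hD o2 q2 (swap _ _ e1) e2)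
      · exact fin p₃ s3.1 (eq_of_eval_conicPoly_eq_zero hD o3 q3 e1 (swap _ _ e2))
      · exact fin p₄ s4.1 (eq_of_eval_conicPoly_eq_zero hD o4 q4 (swap _ _ e1) (swap _ _ e2))
  have hgrowth : growthConstant (halfLogNormSq (A * B) (C * E)) = 4 := by
    have inf : ∀ p, OffSides t₁ t₂ t₃ p → ∃ κ > 0,
        ∀ᶠ z in Bornology.cobounded (EuclideanSpace ℂ (Fin 2)),
          κ * ‖z‖ ^ 2 ≤ triangleDist t₁ t₂ t₃ p z := fun p o =>
      eventually_le_triangleDist_cobounded hD o.1 o.2.1 o.2.2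
    obtain ⟨k1, k2, k3, k4⟩ := pairs (Bornology.cobounded _) (fun z => ‖z‖ ^ 2)
    obtain ⟨κ, hκ, hlow⟩ := exists_eventually_pow_four_le (fun z => sq_nonneg ‖z‖)
      (k1 o1 (inf _ o1)) (k2 o2 (inf _ o2)) (k3 o3 (inf _ o3)) (k4 o4 (inf _ o4))
    obtain ⟨K, hup⟩ := exists_eventually_le_pow_four (g := fun z => ‖z‖ ^ 2)
      (exists_eventually_norm_eval_le (P := A) totalDegree_conicPoly_le)
      (exists_eventually_norm_eval_le (P := B) totalDegree_conicPoly_le)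
      (exists_eventually_norm_eval_le (P := C) totalDegree_conicPoly_le)
      (exists_eventually_norm_eval_le (P := E) totalDegree_conicPoly_le)
    have := growthConstant_halfLogNormSq (P := A * B) (Q := C * E) (k := 4) (c := κ) (C := K) hκ
      (hlow.mono fun z hz => by rw [evl, evl]; simpa [← pow_mul] using hz)
      (hup.mono fun z hz => by rw [evl, evl]; simpa [← pow_mul] using hz)
    simpa using this
  refine ⟨halfLogNormSq (A * B) (C * E), isEntireGreenFunction_halfLogNormSq hzero
    (by rw [hgrowth]; exact EReal.coe_lt_top 4), hgrowth, ⟨{t₁, t₂, t₃}, hTS, hT3, ?_, ?_⟩,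
    A * B, C * E, ?_, ?_, isRelPrime_of_finite S fun z e1 e2 => (hzero z).2 ⟨e1, e2⟩, fun z => rfl⟩
  -- At a vertex all four conics vanish to first order and every pair is transversal, so `|AB|² +
  -- |CE|²` is comparable to `‖z - t‖⁴`.
  · have pole : ∀ t, (∀ p, OffSides t₁ t₂ t₃ p →
        ∃ κ > 0, ∀ᶠ z in 𝓝 t, κ * ‖z - t‖ ≤ triangleDist t₁ t₂ t₃ p z) →
        (∀ p q, MvPolynomial.eval (fun i => t i) (conicPoly t₁ t₂ t₃ p q) = 0) →
        HasLogPole (halfLogNormSq (A * B) (C * E)) 2 t := by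
      intro t near van
      obtain ⟨k1, k2, k3, k4⟩ := pairs (𝓝 t) (fun z => ‖z - t‖)
      obtain ⟨κ, hκ, hlow⟩ := exists_eventually_pow_four_le (fun z => norm_nonneg (z - t))
        (k1 o1 (near _ o1)) (k2 o2 (near _ o2)) (k3 o3 (near _ o3)) (k4 o4 (near _ o4))
      obtain ⟨K, hup⟩ := exists_eventually_le_pow_four (g := fun z => ‖z - t‖)
        (exists_eventually_norm_eval_le_norm_sub (P := A) (van _ _))
        (exists_eventually_norm_eval_le_norm_sub (P := B) (van _ _))
        (exists_eventually_norm_eval_le_norm_sub (P := C) (van _ _))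
        (exists_eventually_norm_eval_le_norm_sub (P := E) (van _ _))
      have := hasLogPole_halfLogNormSq (P := A * B) (Q := C * E) (k := 2) (c := κ) (C := K)
        two_pos hκ (hlow.mono fun z hz => by rw [evl, evl]; simpa using hz)
        (hup.mono fun z hz => by rw [evl, evl]; simpa using hz)
      simpa using this
    have hD2 : cross t₂ t₃ t₁ ≠ 0 := by rw [cross_rotate]; exact hD
    have hD3 : cross t₃ t₁ t₂ ≠ 0 := by rw [cross_rotate]; exact hD2
    intro p hp
    simp only [Finset.mem_insert, Finset.mem_singleton] at hp
    rcases hp with rfl | rfl | rfl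
    · exact pole _ (fun p o => eventually_le_triangleDist_vertex hD o.2.1 o.2.2)
        fun p q => eval_conicPoly_vertex₁
    · refine pole _ (fun q o => ?_) fun p q => eval_conicPoly_vertex₂
      simpa only [triangleDist_rotate] using eventually_le_triangleDist_vertex hD2 o.2.2 o.1
    · refine pole _ (fun q o => ?_) fun p q => eval_conicPoly_vertex₃
      have := eventually_le_triangleDist_vertex hD3 o.1 o.2.1
      rwa [show triangleDist p t₁ t₂ q = triangleDist t₁ t₂ p q from
        funext fun z => (triangleDist_rotate _ _ _ _ _).symm] at this
  · intro p hpS hpT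
    simp only [Finset.mem_insert, Finset.mem_singleton, not_or] at hpT
    have self : ∀ p, OffSides t₁ t₂ t₃ p → ∃ κ > 0, ∀ᶠ z in 𝓝 p,
        κ * ‖z - p‖ ≤ triangleDist t₁ t₂ t₃ p z := fun p o =>
      eventually_le_triangleDist_self hD o.1 o.2.1 o.2.2
    rcases (hmem p).1 ⟨hpS, hpT⟩ with rfl | rfl | rfl | rfl
    · exact hasLogPole_one_of_transversal eval_conicPoly_left eval_conicPoly_left q3
        (hne s2 s4 s1 h24' (Ne.symm n12) (Ne.symm n14)) ((pairs _ _).1 o1 (self _ o1))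
    -- The factors are reordered so that those vanishing at the pole come first in each product.
    · rw [mul_comm C E]
      exact hasLogPole_one_of_transversal eval_conicPoly_right eval_conicPoly_left
        (hne s3 s4 s2 h34' (Ne.symm h23') (Ne.symm h24')) (hne s1 s3 s2 n13 n12 (Ne.symm h23'))
        ((pairs _ _).2.1 o2 (self _ o2))
    · rw [mul_comm A B]
      exact hasLogPole_one_of_transversal eval_conicPoly_left eval_conicPoly_right
        q1 (hne s2 s4 s3 h24' h23' (Ne.symm h34')) ((pairs _ _).2.2.1 o3 (self _ o3))
    · rw [mul_comm A B, mul_comm C E]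
      exact hasLogPole_one_of_transversal eval_conicPoly_right eval_conicPoly_right
        (hne s1 s2 s4 n12 n14 h24') (hne s1 s3 s4 n13 n14 h34')
        ((pairs _ _).2.2.2 o4 (self _ o4))
  · rw [MvPolynomial.totalDegree_mul_of_isDomain (conicPoly_ne_zero hD o1 o2 n12)
      (conicPoly_ne_zero hD o3 o4 h34'), hdeg s1 s2 s3 n12 n13 h23',
      hdeg s3 s4 s1 h34' (Ne.symm n13) (Ne.symm n14)]
  · rw [MvPolynomial.totalDegree_mul_of_isDomain (conicPoly_ne_zero hD o1 o3 n13)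
      (conicPoly_ne_zero hD o2 o4 h24'), hdeg s1 s3 s2 n13 n12 (Ne.symm h23'),
      hdeg s2 s4 s1 h24' (Ne.symm n12) (Ne.symm n14)]
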